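/- Let $\mathbb{F}$ be an arbitrary field. An $m\times n$ \emph{ACI-matrix} over $\mathbb{F}$ is an $m\times n$ matrix whose entries are polynomials of degree at most one over $\mathbb{F}$ such that no indeterminate appears in two different columns. A \emph{completion} is obtained by assigning values in $\mathbb{F}$ to the indeterminates; the matrix has \emph{constant rank} $\rho$ if all its completions have rank $\rho$, and an $m\times n$ ACI-matrix is \emph{full rank} if it has constant rank $\min\{m,n\}$. An $m\times n$ ACI-matrix is \emph{minimal full rank} if it has constant rank $m<n$ and deleting any one of its columns gives a matrix that is not full rank; it is \emph{maximal full rank} if it has constant rank $n<m$ and for every $v\in\mathbb{F}^m$ the augmented matrix $[A\ v]$ is not full rank. Two $m\times n$ ACI-matrices are equivalent, $A\sim B$, if $TAQ=B$ for some nonsingular constant matrix $T$ of order $m$ and some permutation matrix $Q$ of order $n$. A matrix is \emph{unitriangular} if it is square, upper triangular, with all diagonal entries equal to $1$. A $*$ denotes an arbitrary block. Let $A$ be an $m\times n$ ACI-matrix over $\mathbb{F}$. \textbf{(1)} $A$ has constant rank $\rho$ if and only if $$A\sim\begin{bmatrix} B&*&*\\ 0&0&*\\ 0&0&C\end{bmatrix}$$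 (block rows and block columns may be void) for some ACI-matrices $B$ and $C$ such that $B$ is square upper triangular with nonzero constant diagonal entries or is minimal full rank; $C$ is square upper triangular with nonzero constant diagonal entries or is maximal full rank; and the number of rows of $B$ plus the number of columns of $C$ is $\rho$. \textbf{(2)} Suppose that $A$ has constant rank $\rho$ with $1\le\rho\le\min\{m,n\}$. Then: (i) $\rho=m=n$ if and only if $A\sim U$ for a unitriangular ACI-matrix $U$. (ii) $\rho=m<n$ if and only if $A\sim[\,B\ \ *\,]$, a matrix with fewer rows than columns, where either $B$ is unitriangular or $B$ is an $m\times n'$ minimal full rank ACI-matrix with $m<n'\le n$. (iii) $\rho=n<m$ if and only if $A\sim\begin{bmatrix} *\\ C\end{bmatrix}$, a matrix with more rows than columns, where either $C$ is unitriangular or $C$ is an $m'\times n$ maximal full rank ACI-matrix with $n<m'\le m$. (iv) $\rho<\min\{m,n\}$ if and only if one of the following holds, where in each case $B$ is a unitriangular or minimal full rank ACI-matrix, $C$ is a unitriangular or maximal full rank ACI-matrix, $[\,B\ \ *\,]$ has fewer rows than columns, and $\begin{bmatrix} *\\ C\end{bmatrix}$ has more rows than columns: (a) there are positive integers $r<m$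 and $s<n$ with $\rho=(m-r)+(n-s)$ such that $A\sim\begin{bmatrix} B&*&*\\ 0&0&*\\ 0&0&C\end{bmatrix}$, where the zero blocks together form a zero block of size $r\times s$, $[\,B\ \ *\,]$ is the $(m-r)\times s$ block above it and $\begin{bmatrix} *\\ C\end{bmatrix}$ is the $r\times(n-s)$ block to its right; (b) there is a positive integer $r<m$ with $\rho=m-r$ such that $A\sim\begin{bmatrix} B\ \ *\\ 0_{r\times n}\end{bmatrix}$; (c) there is a positive integer $s<n$ with $\rho=n-s$ such that $A\sim\left[\,0_{m\times s}\ \ \begin{matrix} *\\ C\end{matrix}\,\right]$. -/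

import Mathlib

namespace ACI

variable {σ F ι κ : Type*} [Field F] {a b c d : ℕ}

/-- An ACI-matrix over `F`: the entries are polynomials of degree at most one in indeterminates
indexed by `σ`, and no indeterminate appears in two different columns. -/
def IsACI (A : Matrix ι κ (MvPolynomial σ F)) : Prop :=
  (∀ i j, (A i j).totalDegree ≤ 1) ∧
    ∀ i i' j j', j ≠ j' → Disjoint (A i j).vars (A i' j').vars

/-- The completion of `A` given by the values `x` of the indeterminates. -/
noncomputable def completion (A : Matrix ι κ (MvPolynomial σ F)) (x : σ → F) : Matrix ι κ F :=
  A.map (MvPolynomial.eval x)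

/-- The set of the ranks of the completions of `A`. -/
noncomputable def rankSet [Fintype κ] (A : Matrix ι κ (MvPolynomial σ F)) : Set ℕ :=
  Set.range fun x : σ → F => (completion A x).rank

def HasConstantRank [Fintype κ] (A : Matrix ι κ (MvPolynomial σ F)) (ρ : ℕ) : Prop :=
  rankSet A = {ρ}

def IsFullRank [Fintype ι] [Fintype κ] (A : Matrix ι κ (MvPolynomial σ F)) : Prop :=
  HasConstantRank A (min (Fintype.card ι) (Fintype.card κ))

/-- The matrix obtained from `A` by deleting the column `j`. -/
def deleteCol (A : Matrix ι κ (MvPolynomial σ F)) (j : κ) :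
    Matrix ι {j' : κ // j' ≠ j} (MvPolynomial σ F) :=
  A.submatrix id Subtype.val

/-- The matrix `[A v]` obtained from `A` by adding a constant column `v`. -/
noncomputable def augment (A : Matrix ι κ (MvPolynomial σ F)) (v : ι → F) :
    Matrix ι (κ ⊕ Unit) (MvPolynomial σ F) :=
  Matrix.fromCols A (Matrix.of fun i _ => MvPolynomial.C (v i))

def IsMinimalFullRank (A : Matrix (Fin a) (Fin b) (MvPolynomial σ F)) : Prop :=
  IsACI A ∧ HasConstantRank A a ∧ a < b ∧ ∀ j, ¬ IsFullRank (deleteCol A j)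

def IsMaximalFullRank (A : Matrix (Fin a) (Fin b) (MvPolynomial σ F)) : Prop :=
  IsACI A ∧ HasConstantRank A b ∧ b < a ∧ ∀ v : Fin a → F, ¬ IsFullRank (augment A v)

/-- A square upper triangular ACI-matrix with nonzero constant diagonal entries
(order `0` allowed). -/
def IsUpperTriangular (A : Matrix (Fin a) (Fin b) (MvPolynomial σ F)) : Prop :=
  IsACI A ∧ a = b ∧ (∀ (i : Fin a) (j : Fin b), (j : ℕ) < i → A i j = 0) ∧
    ∀ (i : Fin a) (j : Fin b), (i : ℕ) = j → ∃ t : F, t ≠ 0 ∧ A i j = MvPolynomial.C t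

/-- A square upper triangular ACI-matrix with all diagonal entries equal to `1`. -/
def IsUpperUnitriangular (A : Matrix (Fin a) (Fin b) (MvPolynomial σ F)) : Prop :=
  IsACI A ∧ a = b ∧ (∀ (i : Fin a) (j : Fin b), (j : ℕ) < i → A i j = 0) ∧
    ∀ (i : Fin a) (j : Fin b), (i : ℕ) = j → A i j = 1

/-- `A ∼ B`: there are a nonsingular constant matrix `T` and a permutation matrix `Q`
with `T A Q = B`. -/
def Equivalent (A B : Matrix (Fin a) (Fin b) (MvPolynomial σ F)) : Prop :=
  ∃ (T : Matrix (Fin a) (Fin a) F) (Q : Equiv.Perm (Fin b)), IsUnit T ∧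
    (T.map MvPolynomial.C : Matrix (Fin a) (Fin a) (MvPolynomial σ F)) * A *
      Q.permMatrix (MvPolynomial σ F) = B

/-- The matrix `[X Y]`. -/
def hcat {R : Type*} (X : Matrix (Fin a) (Fin b) R) (Y : Matrix (Fin a) (Fin c) R) :
    Matrix (Fin a) (Fin (b + c)) R :=
  (Matrix.fromCols X Y).submatrix id finSumFinEquiv.symm

/-- The matrix with `X` on top of `Y`. -/
def vcat {R : Type*} (X : Matrix (Fin a) (Fin c) R) (Y : Matrix (Fin b) (Fin c) R) :
    Matrix (Fin (a + b)) (Fin c) R :=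
  (Matrix.fromRows X Y).submatrix finSumFinEquiv.symm id

/-- The block matrix `[[B, X, Y], [0, 0, Z], [0, 0, C]]`; any block may be void. -/
def blockMatrix {R : Type*} [Zero R] {p k u q l v : ℕ} (B : Matrix (Fin p) (Fin q) R)
    (X : Matrix (Fin p) (Fin l) R) (Y : Matrix (Fin p) (Fin v) R) (Z : Matrix (Fin k) (Fin v) R)
    (C : Matrix (Fin u) (Fin v) R) : Matrix (Fin (p + k + u)) (Fin (q + l + v)) R :=
  vcat (vcat (hcat (hcat B X) Y) (hcat (hcat 0 0) Z)) (hcat (hcat 0 0) C)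

/-- `A ∼ [[B, *, *], [0, 0, *], [0, 0, C]]` with `B` triangular or minimal full rank, `C` triangular
or maximal full rank, and (number of rows of `B`) + (number of columns of `C`) equal to `ρ`. -/
def HasBlockForm {m n : ℕ} (A : Matrix (Fin m) (Fin n) (MvPolynomial σ F)) (ρ : ℕ) : Prop :=
  ∃ (p k u q l v : ℕ) (hm : m = p + k + u) (hn : n = q + l + v)
    (B : Matrix (Fin p) (Fin q) (MvPolynomial σ F))
    (X : Matrix (Fin p) (Fin l) (MvPolynomial σ F))
    (Y : Matrix (Fin p) (Fin v) (MvPolynomial σ F))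
    (Z : Matrix (Fin k) (Fin v) (MvPolynomial σ F))
    (C : Matrix (Fin u) (Fin v) (MvPolynomial σ F)),
    (IsUpperTriangular B ∨ IsMinimalFullRank B) ∧
    (IsUpperTriangular C ∨ IsMaximalFullRank C) ∧
    p + v = ρ ∧
    Equivalent A ((blockMatrix B X Y Z C).submatrix (Fin.cast hm) (Fin.cast hn))

/-- `A ∼ [B *]`, a matrix with fewer rows than columns, where `B` is unitriangular, or `m × n'`
minimal full rank with `m < n' ≤ n`. -/
def HasRowForm {m n : ℕ} (A : Matrix (Fin m) (Fin n) (MvPolynomial σ F)) : Prop :=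
  m < n ∧ ∃ (n' l : ℕ) (hn : n = n' + l)
    (B : Matrix (Fin m) (Fin n') (MvPolynomial σ F))
    (X : Matrix (Fin m) (Fin l) (MvPolynomial σ F)),
    (IsUpperUnitriangular B ∨ (IsMinimalFullRank B ∧ m < n' ∧ n' ≤ n)) ∧
    Equivalent A ((hcat B X).submatrix id (Fin.cast hn))

/-- `A ∼ [*; C]`, a matrix with more rows than columns, where `C` is unitriangular, or `m' × n`
maximal full rank with `n < m' ≤ m`. -/
def HasColForm {m n : ℕ} (A : Matrix (Fin m) (Fin n) (MvPolynomial σ F)) : Prop :=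
  n < m ∧ ∃ (m' k : ℕ) (hm : m = k + m')
    (Z : Matrix (Fin k) (Fin n) (MvPolynomial σ F))
    (C : Matrix (Fin m') (Fin n) (MvPolynomial σ F)),
    (IsUpperUnitriangular C ∨ (IsMaximalFullRank C ∧ n < m' ∧ m' ≤ m)) ∧
    Equivalent A ((vcat Z C).submatrix (Fin.cast hm) id)

/-- Pattern (a): for some positive `r < m` and `s < n` with `ρ = (m - r) + (n - s)`,
`A ∼ [[B, *, *], [0, 0, *], [0, 0, C]]` with zero block of size `r × s`, where `[B *]` has fewer
rows than columns and `[*; C]` has more rows than columns. The equations `hm`, `hn` say that the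
zero block has `k + u = r` rows and `q + l = s` columns. -/
def PatternA {m n : ℕ} (A : Matrix (Fin m) (Fin n) (MvPolynomial σ F)) (ρ : ℕ) : Prop :=
  ∃ r s : ℕ, 0 < r ∧ r < m ∧ 0 < s ∧ s < n ∧ ρ = (m - r) + (n - s) ∧
    m - r < s ∧ n - s < r ∧
    ∃ (k u q l : ℕ) (hm : m = m - r + k + u) (hn : n = q + l + (n - s))
      (B : Matrix (Fin (m - r)) (Fin q) (MvPolynomial σ F))
      (X : Matrix (Fin (m - r)) (Fin l) (MvPolynomial σ F))
      (Y : Matrix (Fin (m - r)) (Fin (n - s)) (MvPolynomial σ F))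
      (Z : Matrix (Fin k) (Fin (n - s)) (MvPolynomial σ F))
      (C : Matrix (Fin u) (Fin (n - s)) (MvPolynomial σ F)),
      (IsUpperUnitriangular B ∨ IsMinimalFullRank B) ∧
      (IsUpperUnitriangular C ∨ IsMaximalFullRank C) ∧
      Equivalent A ((blockMatrix B X Y Z C).submatrix (Fin.cast hm) (Fin.cast hn))

/-- Pattern (b): for some positive `r < m` with `ρ = m - r`, `A ∼ [[B, *], [0]]` with zero block of
size `r × n`, where `[B *]` has fewer rows than columns. -/
def PatternB {m n : ℕ} (A : Matrix (Fin m) (Fin n) (MvPolynomial σ F)) (ρ : ℕ) : Prop :=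
  ∃ r : ℕ, 0 < r ∧ r < m ∧ ρ = m - r ∧ m - r < n ∧
    ∃ (q l : ℕ) (hm : m = m - r + r) (hn : n = q + l)
      (B : Matrix (Fin (m - r)) (Fin q) (MvPolynomial σ F))
      (X : Matrix (Fin (m - r)) (Fin l) (MvPolynomial σ F)),
      (IsUpperUnitriangular B ∨ IsMinimalFullRank B) ∧
      Equivalent A
        ((vcat (hcat B X) (0 : Matrix (Fin r) (Fin (q + l)) (MvPolynomial σ F))).submatrix
          (Fin.cast hm) (Fin.cast hn))

/-- Pattern (c): for some positive `s < n` with `ρ = n - s`, `A ∼ [0, [*; C]]` with zero block of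
size `m × s`, where `[*; C]` has more rows than columns. -/
def PatternC {m n : ℕ} (A : Matrix (Fin m) (Fin n) (MvPolynomial σ F)) (ρ : ℕ) : Prop :=
  ∃ s : ℕ, 0 < s ∧ s < n ∧ ρ = n - s ∧ n - s < m ∧
    ∃ (k u : ℕ) (hm : m = k + u) (hn : n = s + (n - s))
      (Z : Matrix (Fin k) (Fin (n - s)) (MvPolynomial σ F))
      (C : Matrix (Fin u) (Fin (n - s)) (MvPolynomial σ F)),
      (IsUpperUnitriangular C ∨ IsMaximalFullRank C) ∧
      Equivalent A
        ((hcat (0 : Matrix (Fin (k + u)) (Fin s) (MvPolynomial σ F)) (vcat Z C)).submatrix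
          (Fin.cast hm) (Fin.cast hn))

end ACI

/-! The columns of an ACI-matrix can be completed independently of each other, so its completions
are the transversals of the affine sets `colSet A j` in F^m. Rado's theorem, valid over every field,
finite ones included, controls their ranks: if no transversal has rank above ρ, then some set S of
columns satisfies dim U + (n - |S|) ≤ ρ, where U is the span of all values of the columns in S
(`exists_spanOf_of_rank_le`).

In a basis adapted to U the columns of S vanish below the first dim U rows, which gives the shape
[[M, Y], [0, N]]. As every completion also has rank at least ρ, M must have full row rank and N full
column rank (`IsACI.exists_fromBlocks`). Keep as few columns of M as full row rank allows, and pass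
to a quotient of the column space of least dimension in which the columns of N stay independent. The
results are square, or else minimal and maximal full rank respectively (`IsACI.exists_fromCols`,
`IsACI.exists_fromRows`).

In the square case all transversals are bases. Rado's theorem modulo a subspace shows that outside
every proper set of columns with tight span there is a column that is constant modulo this span
(`exists_constant_mod_spanOf`). Ordering the columns accordingly and multiplying by the inverse of
one completion makes the matrix unitriangular (`IsACI.exists_unitriangular`).

Conversely, a right invertible M and a left invertible N force the rank of [[M, Y], [0, N]]
(`rank_fromBlocks_eq`). Part (2) follows from the same reductions; in (iv) the void blocks decide
the pattern. -/

open Finset Module Submodule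

namespace ACI

/-! ### Rado's theorem and transversals of families of affine sets. -/

section Transversals

variable {F V κ : Type*} [Field F] [AddCommGroup V] [Module F V]

/-- The subspace spanned by the sets `L i` with `i ∈ s`. -/
def spanOf (F : Type*) {V κ : Type*} [Field F] [AddCommGroup V] [Module F V]
    (L : κ → Set V) (s : Finset κ) : Submodule F V :=
  s.sup fun i => span F (L i)

lemma spanOf_union [DecidableEq κ] (L : κ → Set V) (s t : Finset κ) :
    spanOf F L (s ∪ t) = spanOf F L s ⊔ spanOf F L t := Finset.sup_union

lemma spanOf_insert [DecidableEq κ] (L : κ → Set V) (i : κ) (s : Finset κ) :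
    spanOf F L (insert i s) = span F (L i) ⊔ spanOf F L s := Finset.sup_insert

lemma spanOf_mono (L : κ → Set V) {s t : Finset κ} (h : s ⊆ t) :
    spanOf F L s ≤ spanOf F L t := Finset.sup_mono h

lemma subset_spanOf (L : κ → Set V) {s : Finset κ} {i : κ} (hi : i ∈ s) :
    L i ⊆ spanOf F L s := fun _ hx =>
  (Finset.le_sup (f := fun i => span F (L i)) hi) (subset_span hx)

lemma spanOf_le {L : κ → Set V} {s : Finset κ} {U : Submodule F V} :
    spanOf F L s ≤ U ↔ ∀ i ∈ s, L i ⊆ U := by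
  simp [spanOf, Finset.sup_le_iff, span_le]

lemma spanOf_congr {L L' : κ → Set V} {s : Finset κ} (h : ∀ i ∈ s, L i = L' i) :
    spanOf F L s = spanOf F L' s :=
  Finset.sup_congr rfl fun i hi => by rw [h i hi]

lemma spanOf_empty (L : κ → Set V) : spanOf F L ∅ = ⊥ := Finset.sup_empty

variable [FiniteDimensional F V]

lemma finrank_sup_span_singleton_le (D : Submodule F V) (x : V) :
    finrank F ↥(D ⊔ span F {x}) ≤ finrank F D + 1 := by
  have h1 := Submodule.finrank_add_le_finrank_add_finrank D (span F {x})
  have h2 := finrank_span_le_card (R := F) ({x} : Set V)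
  simp at h2
  omega

variable [DecidableEq κ]

/-- Rado's theorem on independent transversals, modulo a subspace `D`. -/
theorem exists_independent_transversal (L : κ → Set V) (s : Finset κ) (D : Submodule F V)
    (h : ∀ R ⊆ s, finrank F D + #R ≤ finrank F ↥(D ⊔ spanOf F L R)) :
    ∃ c : κ → V, (∀ i ∈ s, c i ∈ L i) ∧
      finrank F D + #s ≤ finrank F ↥(D ⊔ spanOf F (fun i => {c i}) s) := by
  induction hn : #s using Nat.strong_induction_on generalizing s D with
  | _ n ih =>
  subst hn
  rcases s.eq_empty_or_nonempty with rfl | ⟨j, hj⟩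
  · exact ⟨fun _ => 0, by simp, by simpa using finrank_mono le_sup_left⟩
  -- If the condition is tight on a proper nonempty R, a transversal of R already fills D ⊔ span
  -- L_R. The rest of s is then handled modulo this larger subspace, where the condition persists.
  by_cases htight : ∃ R ⊂ s, R.Nonempty ∧ finrank F ↥(D ⊔ spanOf F L R) ≤ finrank F D + #R
  · obtain ⟨R, hRs, hRne, hR⟩ := htight
    obtain ⟨c₁, hc₁, hr₁⟩ := ih _ (card_lt_card hRs) R D
      (fun Q hQ => h Q (hQ.trans hRs.subset)) rfl
    have hle : spanOf F (fun i => {c₁ i}) R ≤ spanOf F L R :=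
      spanOf_le.2 fun i hi => Set.singleton_subset_iff.2 (subset_spanOf L hi (hc₁ i hi))
    have heq : D ⊔ spanOf F (fun i => {c₁ i}) R = D ⊔ spanOf F L R :=
      Submodule.eq_of_le_of_finrank_le (sup_le_sup_left hle _) (hR.trans hr₁)
    have hcard : #(s \ R) + #R = #s := card_sdiff_add_card_eq_card hRs.subset
    have hRpos := hRne.card_pos
    obtain ⟨c₂, hc₂, hr₂⟩ := ih #(s \ R) (by omega) (s \ R) (D ⊔ spanOf F L R) (by
      intro Q hQ
      have hdisj : Disjoint R Q :=
        disjoint_of_subset_right hQ disjoint_sdiff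
      have := h (R ∪ Q) (union_subset hRs.subset (hQ.trans sdiff_subset))
      rw [spanOf_union, ← sup_assoc, card_union_of_disjoint hdisj] at this
      omega) rfl
    refine ⟨fun i => if i ∈ R then c₁ i else c₂ i, fun i hi => ?_, ?_⟩
    · by_cases hiR : i ∈ R
      · simpa [hiR] using hc₁ i hiR
      · simpa [hiR] using hc₂ i (mem_sdiff.2 ⟨hi, hiR⟩)
    · have e1 : spanOf F (fun i => {if i ∈ R then c₁ i else c₂ i}) R
          = spanOf F (fun i => {c₁ i}) R := spanOf_congr fun i hi => by simp [hi]
      have e2 : spanOf F (fun i => {if i ∈ R then c₁ i else c₂ i}) (s \ R)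
          = spanOf F (fun i => {c₂ i}) (s \ R) :=
        spanOf_congr fun i hi => by simp [(mem_sdiff.1 hi).2]
      have e3 := spanOf_union (F := F)
        (fun i => ({if i ∈ R then c₁ i else c₂ i} : Set V)) R (s \ R)
      rw [union_sdiff_of_subset hRs.subset, e1, e2] at e3
      rw [e3, ← sup_assoc, heq]
      rw [heq] at hr₁
      omega
  -- Now every proper nonempty subfamily has slack at least one, so any element of L j outside D may
  -- be chosen: adjoining it to D costs just one dimension.
  · push Not at htight
    have hjD : ∃ x ∈ L j, x ∉ D := by
      by_contra! hcon
      have h1 := h {j} (by simpa using hj)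
      have h2 : spanOf F L {j} ≤ D := spanOf_le.2 (by simpa [Set.subset_def] using hcon)
      rw [sup_eq_left.2 h2] at h1
      simp at h1
    obtain ⟨x, hx, hxD⟩ := hjD
    have hD' : finrank F ↥(D ⊔ span F {x}) = finrank F D + 1 := by
      refine le_antisymm (finrank_sup_span_singleton_le D x) ?_
      refine finrank_lt_finrank_of_lt (lt_of_le_of_ne le_sup_left fun he => hxD ?_)
      rw [he]
      exact mem_sup_right (mem_span_singleton_self x)
    have hcard := card_erase_add_one hj
    obtain ⟨c, hc, hr⟩ := ih #(s.erase j) (by omega) (s.erase j) (D ⊔ span F {x}) (by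
      intro R hR
      rcases R.eq_empty_or_nonempty with rfl | hne
      · simpa using finrank_mono le_sup_left
      have hRs : R ⊂ s := Finset.ssubset_of_subset_of_ssubset hR (erase_ssubset hj)
      have h1 := htight R hRs hne
      have h2 : finrank F ↥(D ⊔ spanOf F L R) ≤ finrank F ↥(D ⊔ span F {x} ⊔ spanOf F L R) :=
        finrank_mono (sup_le_sup_right le_sup_left _)
      omega) rfl
    refine ⟨Function.update c j x, fun i hi => ?_, ?_⟩
    · rcases eq_or_ne i j with rfl | hij
      · simpa using hx
      · simpa [hij] using hc i (mem_erase.2 ⟨hij, hi⟩)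
    · have e1 : spanOf F (fun i => {Function.update c j x i}) (s.erase j)
          = spanOf F (fun i => {c i}) (s.erase j) :=
        spanOf_congr fun i hi => by simp [(mem_erase.1 hi).1]
      have e2 := spanOf_insert (F := F)
        (fun i => ({Function.update c j x i} : Set V)) j (s.erase j)
      rw [insert_erase hj, e1] at e2
      simp only [Function.update_self] at e2
      rw [e2, ← sup_assoc]
      omega

/-- Submodularity of the dimension; the inequality can be strict because span L_(R ∩ Q) may be
smaller than the intersection of the two spans. -/
lemma finrank_spanOf_union_add_inter_le (L : κ → Set V) (R Q : Finset κ) :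
    finrank F (spanOf F L (R ∪ Q)) + finrank F (spanOf F L (R ∩ Q)) ≤
      finrank F (spanOf F L R) + finrank F (spanOf F L Q) := by
  have h1 := Submodule.finrank_sup_add_finrank_inf_eq (spanOf F L R) (spanOf F L Q)
  have h2 : finrank F (spanOf F L (R ∩ Q)) ≤ finrank F ↥(spanOf F L R ⊓ spanOf F L Q) :=
    finrank_mono (le_inf (spanOf_mono L inter_subset_left) (spanOf_mono L inter_subset_right))
  rw [spanOf_union]
  omega

/-- A family whose sets span with defect at most `d` satisfies Rado's condition after removing
at most `d` of its members. -/
lemma exists_subset_of_defect (L : κ → Set V) (d : ℕ) (s : Finset κ)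
    (h : ∀ R ⊆ s, #R ≤ finrank F (spanOf F L R) + d) :
    ∃ t ⊆ s, #s ≤ #t + d ∧ ∀ R ⊆ t, #R ≤ finrank F (spanOf F L R) := by
  induction d generalizing s with
  | zero => exact ⟨s, Subset.rfl, by simp, by simpa using h⟩
  | succ d ih =>
    by_cases htight : ∃ R ⊆ s, finrank F (spanOf F L R) + (d + 1) ≤ #R
    · obtain ⟨R₀, ⟨hR₀s, hR₀⟩, hmin⟩ : ∃ R₀ : Finset κ,
          (R₀ ⊆ s ∧ finrank F (spanOf F L R₀) + (d + 1) ≤ #R₀) ∧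
          ∀ R : Finset κ, R ⊆ s → finrank F (spanOf F L R) + (d + 1) ≤ #R → #R₀ ≤ #R := by
        obtain ⟨R₁, h₁⟩ := htight
        obtain ⟨R₀, h₀, hmin⟩ := (s.powerset.filter
          fun R => finrank F (spanOf F L R) + (d + 1) ≤ #R).exists_min_image card
          ⟨R₁, by simpa using h₁⟩
        refine ⟨R₀, by simpa using h₀, fun R hR hR' => hmin R (by simpa using ⟨hR, hR'⟩)⟩
      obtain ⟨j, hj⟩ : R₀.Nonempty := card_pos.1 (by omega)
      obtain ⟨t, hts, ht, hcond⟩ := ih (s.erase j) (by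
        intro R hR
        -- If R avoids j and has defect d + 1, submodularity gives the same defect to R ∩ R₀.
        -- Minimality makes this R₀, so j lies in R after all.
        by_contra! hlt
        have hRs : R ⊆ s := hR.trans (erase_subset _ _)
        have h1 := finrank_spanOf_union_add_inter_le (F := F) L R R₀
        have h2 := card_union_add_card_inter R R₀
        have h3 := h (R ∪ R₀) (union_subset hRs hR₀s)
        have h4 := hmin (R ∩ R₀) (inter_subset_left.trans hRs) (by omega)
        have h5 : R ∩ R₀ = R₀ := eq_of_subset_of_card_le inter_subset_right h4
        have h6 : j ∈ R := by
          rw [← h5] at hj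
          exact (mem_inter.1 hj).1
        exact (mem_erase.1 (hR h6)).1 rfl)
      refine ⟨t, hts.trans (erase_subset _ _), ?_, hcond⟩
      have := card_erase_add_one (hR₀s hj)
      omega
    · push Not at htight
      obtain ⟨t, hts, ht, hcond⟩ := ih s fun R hR => by have := htight R hR; omega
      exact ⟨t, hts, by omega, hcond⟩

/-- If all transversals of a family of nonempty sets have rank at most `ρ`, this is witnessed by
the span of a subfamily. -/
theorem exists_spanOf_of_rank_le [Fintype κ] (L : κ → Set V) (hne : ∀ i, (L i).Nonempty) (ρ : ℕ)
    (h : ∀ c : κ → V, (∀ i, c i ∈ L i) → finrank F (span F (Set.range c)) ≤ ρ) :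
    ∃ S : Finset κ, finrank F (spanOf F L S) + Fintype.card κ ≤ ρ + #S := by
  by_contra! hcon
  -- The empty set gives ρ < |κ|, so the truncated subtraction |κ| - ρ - 1 below is exact and at
  -- least ρ + 1 members survive the deletion.
  have h0 := hcon ∅
  rw [spanOf_empty, finrank_bot, card_empty] at h0
  obtain ⟨t, -, ht, hcond⟩ := exists_subset_of_defect (F := F) L (Fintype.card κ - ρ - 1) univ
    fun R _ => by have := hcon R; omega
  obtain ⟨c, hc, hr⟩ := exists_independent_transversal L t (⊥ : Submodule F V) (by
    intro R hR
    rw [bot_sup_eq, finrank_bot, zero_add]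
    exact hcond R hR)
  choose x hx using hne
  have h1 := h (fun i => if i ∈ t then c i else x i) (fun i => by
    by_cases hi : i ∈ t
    · simpa [hi] using hc i hi
    · simpa [hi] using hx i)
  have h2 : spanOf F (fun i => {c i}) t ≤
      span F (Set.range fun i => if i ∈ t then c i else x i) :=
    spanOf_le.2 fun i hi => Set.singleton_subset_iff.2 (subset_span ⟨i, by simp [hi]⟩)
  have h3 := finrank_mono h2
  rw [bot_sup_eq, finrank_bot, zero_add] at hr
  simp only [card_univ] at ht
  omega

/-- In a family of affine sets all of whose transversals are bases, a proper subfamily whose span has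
at most its cardinality as dimension leaves out a member that is constant modulo this span. -/
lemma exists_constant_mod_spanOf [Fintype κ] (L : κ → Set V) (hne : ∀ i, (L i).Nonempty)
    (haff : ∀ i, ∀ x ∈ L i, ∀ y ∈ L i, ∀ t : F, x + t • (y - x) ∈ L i)
    (hV : finrank F V = Fintype.card κ)
    (h : ∀ c : κ → V, (∀ i, c i ∈ L i) → LinearIndependent F c)
    (S : Finset κ) (hS : S ≠ univ) (hSr : finrank F (spanOf F L S) ≤ #S) :
    ∃ j ∉ S, ∀ x ∈ L j, ∀ y ∈ L j, y - x ∈ spanOf F L S := by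
  -- A smallest tight set strictly containing S; the whole family is a candidate. Any member of T
  -- outside S will turn out to be constant modulo span L_S.
  obtain ⟨T, ⟨hST, hT⟩, hmin⟩ : ∃ T : Finset κ, (S ⊂ T ∧ finrank F (spanOf F L T) ≤ #T) ∧
      ∀ R : Finset κ, S ⊂ R → finrank F (spanOf F L R) ≤ #R → #T ≤ #R := by
    obtain ⟨T, h₀, hmin⟩ := ((univ : Finset (Finset κ)).filter
      fun R => S ⊂ R ∧ finrank F (spanOf F L R) ≤ #R).exists_min_image card
      ⟨univ, by
        simp only [mem_filter, mem_univ, true_and]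
        exact ⟨Finset.ssubset_univ_iff.2 hS, by
          rw [card_univ, ← hV]; exact Submodule.finrank_le _⟩⟩
    exact ⟨T, by simpa using h₀, fun R hR hR' => hmin R (by simpa using ⟨hR, hR'⟩)⟩
  obtain ⟨j, hjT, hjS⟩ := exists_of_ssubset hST
  refine ⟨j, hjS, fun x hx y hy => ?_⟩
  by_contra hw
  set w := y - x with hwdef
  have hfw : finrank F ↥(spanOf F L S ⊔ span F {w}) ≤ #S + 1 :=
    (finrank_sup_span_singleton_le _ w).trans (by omega)
  choose b hb using hne
  have hindep : ∀ c : κ → V, (∀ i, c i ∈ L i) → ∀ R : Finset κ,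
      finrank F (spanOf F (fun i => {c i}) R) = #R := by
    intro c hc R
    have h1 : spanOf F (fun i => {c i}) R = span F (Set.range fun i : R => c i) := by
      apply le_antisymm
      · exact spanOf_le.2 fun i hi => Set.singleton_subset_iff.2 (subset_span ⟨⟨i, hi⟩, rfl⟩)
      · rw [span_le]
        rintro _ ⟨⟨i, hi⟩, rfl⟩
        exact subset_spanOf (fun i => {c i}) hi rfl
    rw [h1]
    exact (finrank_span_eq_card ((h c hc).comp _ Subtype.val_injective)).trans (by simp)
  have hlt : finrank F (spanOf F L S) < finrank F ↥(spanOf F L S ⊔ span F {w}) := by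
    refine finrank_lt_finrank_of_lt (lt_of_le_of_ne le_sup_left fun he => hw ?_)
    rw [he]
    exact mem_sup_right (mem_span_singleton_self w)
  have hspanS : ∀ c : κ → V, (∀ i, c i ∈ L i) → spanOf F (fun i => {c i}) S = spanOf F L S :=
    fun c hc => Submodule.eq_of_le_of_finrank_le
      (spanOf_le.2 fun i hi => Set.singleton_subset_iff.2 (subset_spanOf L hi (hc i)))
      (by rw [hindep c hc S]; exact hSr)
  have hSge : #S ≤ finrank F (spanOf F L S) := by rw [← hspanS b hb, hindep b hb]
  -- Rado's condition holds modulo span L_S + F w, of dimension |S| + 1: for nonempty R, the set S ∪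
  -- R lies strictly between S and T, so by minimality its span has dimension greater than |S| +
  -- |R|.
  obtain ⟨c, hc, hr⟩ := exists_independent_transversal L ((T \ S).erase j)
    (spanOf F L S ⊔ span F {w}) (by
      intro R hR
      by_contra! hlt'
      rcases R.eq_empty_or_nonempty with rfl | hRne
      · have : finrank F ↥(spanOf F L S ⊔ span F {w}) ≤
            finrank F ↥(spanOf F L S ⊔ span F {w} ⊔ spanOf F L ∅) := finrank_mono le_sup_left
        simp only [card_empty] at hlt'
        omega
      have hRT : R ⊆ T \ S := hR.trans (erase_subset _ _)
      have hdisj : Disjoint S R := disjoint_of_subset_right hRT disjoint_sdiff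
      have hle : finrank F (spanOf F L (S ∪ R)) ≤
          finrank F ↥(spanOf F L S ⊔ span F {w} ⊔ spanOf F L R) := by
        rw [spanOf_union]
        exact finrank_mono (sup_le_sup_right le_sup_left _)
      have hcardU := card_union_of_disjoint hdisj
      have hss : S ⊂ S ∪ R := by
        refine Finset.ssubset_iff_subset_ne.2 ⟨subset_union_left, fun he => ?_⟩
        rw [← he] at hcardU
        have := hRne.card_pos
        omega
      have h1 := hmin (S ∪ R) hss (by omega)
      have h2 : S ∪ R = T := eq_of_subset_of_card_le
        (union_subset hST.subset (hRT.trans sdiff_subset)) h1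
      rw [← h2] at hjT
      rcases mem_union.1 hjT with hj | hj
      · exact hjS hj
      · exact (mem_erase.1 (hR hj)).1 rfl)
  -- a transversal extending `c`, with the value at `j` to be moved along `w`
  set c' : κ → V := fun i => if i ∈ (T \ S).erase j then c i else if i = j then x else b i with hc'
  have hc'L : ∀ i, c' i ∈ L i := by
    intro i
    by_cases hi : i ∈ (T \ S).erase j
    · simpa only [hc', if_pos hi] using hc i hi
    · by_cases hij : i = j
      · subst hij; simpa [hc'] using hx
      · have : c' i = b i := by simp only [hc', if_neg hi, if_neg hij]
        rw [this]; exact hb i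
  set P := spanOf F (fun i => {c' i}) (T.erase j) with hP
  have hTe : T.erase j = S ∪ (T \ S).erase j := by
    rw [← erase_eq_of_notMem hjS, ← erase_union_distrib, erase_eq_of_notMem hjS,
      union_sdiff_of_subset hST.subset]
  have hPeq : P = spanOf F L S ⊔ spanOf F (fun i => {c i}) ((T \ S).erase j) := by
    rw [hP, hTe, spanOf_union, hspanS c' hc'L]
    congr 1
    exact spanOf_congr fun i hi => by simp only [hc', if_pos hi]
  have hcardT : #((T \ S).erase j) + 1 = #(T \ S) :=
    card_erase_add_one (mem_sdiff.2 ⟨hjT, hjS⟩)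
  have hcardT' : #(T \ S) + #S = #T := card_sdiff_add_card_eq_card hST.subset
  -- The left side lies in span L_T, has dimension at least (|S| + 1) + (|T| - |S| - 1) = |T|, and
  -- span L_T has dimension at most |T|.
  have hPw : P ⊔ span F {w} = spanOf F L T := by
    apply Submodule.eq_of_le_of_finrank_le
    · apply sup_le
      · exact spanOf_le.2 fun i hi => Set.singleton_subset_iff.2
          (subset_spanOf L (mem_of_mem_erase hi) (hc'L i))
      · rw [span_singleton_le_iff_mem]
        exact sub_mem (subset_spanOf L hjT hy) (subset_spanOf L hjT hx)
    · rw [hPeq, sup_right_comm]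
      omega
  have hxP : x ∈ P ⊔ span F {w} := hPw ▸ subset_spanOf L hjT hx
  obtain ⟨z, hz, v, hv, hzv⟩ := Submodule.mem_sup.1 hxP
  obtain ⟨t, rfl⟩ := mem_span_singleton.1 hv
  -- From x = z + t w, the vector z = x - t w of P is on the line through x and y, hence an
  -- admissible value at j. With it, |T| independent vectors would lie in P, of dimension |T| - 1.
  have hc''L : ∀ i, Function.update c' j z i ∈ L i := by
    intro i
    rcases eq_or_ne i j with rfl | hij
    · have : z = x + (-t) • (y - x) := by rw [← hwdef, ← hzv]; module
      simpa [this] using haff i x hx y hy (-t)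
    · simpa [hij] using hc'L i
  have h1 := hindep _ hc''L T
  have h2 := hindep _ hc'L (T.erase j)
  have h3 : spanOf F (fun i => {Function.update c' j z i}) T ≤ P := by
    refine spanOf_le.2 fun i hi => Set.singleton_subset_iff.2 ?_
    rcases eq_or_ne i j with rfl | hij
    · simpa using hz
    · rw [Function.update_of_ne hij]
      exact subset_spanOf (fun i => {c' i}) (mem_erase.2 ⟨hij, hi⟩) rfl
  have h4 := finrank_mono h3
  have h5 := card_erase_add_one hjT
  rw [← hP] at h2
  omega

/-- A family of affine sets all of whose transversals are bases can be ordered so that each member is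
constant modulo the span of the preceding ones. -/
theorem exists_triangular_order (n : ℕ) (L : Fin n → Set V) (hne : ∀ i, (L i).Nonempty)
    (haff : ∀ i, ∀ x ∈ L i, ∀ y ∈ L i, ∀ t : F, x + t • (y - x) ∈ L i)
    (hV : finrank F V = n)
    (h : ∀ c : Fin n → V, (∀ i, c i ∈ L i) → LinearIndependent F c) :
    ∃ e : Equiv.Perm (Fin n), ∀ i, ∀ x ∈ L (e i), ∀ y ∈ L (e i),
      y - x ∈ spanOf F (fun j => L (e j)) (univ.filter (· < i)) := by
  rcases Nat.eq_zero_or_pos n with rfl | hn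
  · exact ⟨Equiv.refl _, fun i => i.elim0⟩
  -- The order is built one index at a time. The bound on the dimension is carried along because it
  -- is the tightness needed to find the next index.
  have key : ∀ k ≤ n, ∃ g : ℕ → Fin n, Set.InjOn g (range k) ∧
      finrank F (spanOf F L ((range k).image g)) ≤ k ∧
      ∀ i < k, ∀ x ∈ L (g i), ∀ y ∈ L (g i), y - x ∈ spanOf F L ((range i).image g) := by
    intro k hk
    induction k with
    | zero => exact ⟨fun _ => ⟨0, hn⟩, by simp,
      by rw [range_zero, image_empty, spanOf_empty, finrank_bot], by simp⟩
    | succ k ih =>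
      obtain ⟨g, hinj, hfr, hg⟩ := ih (by omega)
      have hcard : #((range k).image g) = k := by rw [card_image_of_injOn hinj, card_range]
      obtain ⟨j, hj, hjL⟩ := exists_constant_mod_spanOf L hne haff (by simpa using hV) h
        ((range k).image g) (fun he => by
          rw [he, card_univ, Fintype.card_fin] at hcard
          omega) (by omega)
      have hupd : ∀ i ≤ k, (range i).image (Function.update g k j) = (range i).image g :=
        fun i hi => image_congr fun a ha => by
          have : a < i := by simpa using ha
          rw [Function.update_of_ne (by omega)]
      refine ⟨Function.update g k j, ?_, ?_, ?_⟩
      · intro a ha b hb hab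
        simp only [coe_range, Set.mem_Iio] at ha hb
        have hne' : ∀ a < k, g a ≠ j := fun a ha he =>
          hj (mem_image.2 ⟨a, mem_range.2 ha, he⟩)
        by_cases hak : a = k <;> by_cases hbk : b = k
        · omega
        · subst hak
          rw [Function.update_self, Function.update_of_ne hbk] at hab
          exact absurd hab.symm (hne' b (by omega))
        · subst hbk
          rw [Function.update_self, Function.update_of_ne hak] at hab
          exact absurd hab (hne' a (by omega))
        · rw [Function.update_of_ne hak, Function.update_of_ne hbk] at hab
          exact hinj (by simp; omega) (by simp; omega) hab
      · rw [range_add_one, image_insert, Function.update_self, hupd k le_rfl, spanOf_insert]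
        obtain ⟨x, hx⟩ := hne j
        -- Being constant modulo the previous span, L j enlarges it by at most the one vector x, so
        -- tightness is preserved.
        have hle : span F (L j) ⊔ spanOf F L ((range k).image g) ≤
            spanOf F L ((range k).image g) ⊔ span F {x} := by
          refine sup_le (span_le.2 fun y hy => ?_) le_sup_left
          rw [show y = (y - x) + x by abel]
          exact add_mem (mem_sup_left (hjL x hx y hy))
            (mem_sup_right (mem_span_singleton_self x))
        have h1 := finrank_mono hle
        have h2 := finrank_sup_span_singleton_le (spanOf F L ((range k).image g)) x
        omega
      · intro i hi
        rw [hupd i (by omega)]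
        by_cases hik : i = k
        · subst hik
          simpa using hjL
        · rw [Function.update_of_ne hik]
          exact hg i (by omega)
  obtain ⟨g, hinj, -, hg⟩ := key n le_rfl
  have hbij : Function.Bijective fun i : Fin n => g i :=
    (Finite.injective_iff_bijective).1 fun a b hab =>
      Fin.ext (hinj (by simp) (by simp) hab)
  refine ⟨Equiv.ofBijective _ hbij, fun i x hx y hy => ?_⟩
  refine (spanOf_le.2 fun a ha => ?_) (hg i i.2 x hx y hy)
  obtain ⟨b, hb, rfl⟩ := mem_image.1 ha
  have hb' : b < i := by simpa using hb
  exact subset_spanOf (F := F) (fun j => L (Equiv.ofBijective _ hbij j))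
    (i := ⟨b, hb'.trans i.2⟩) (mem_filter.2 ⟨mem_univ _, hb'⟩)

end Transversals

/-! ### Polynomials of degree at most one as functions. -/

section Polynomials

variable {σ F : Type*} [Field F]

lemma eq_zero_or_single_of_degree_le_one {d : σ →₀ ℕ} (hd : (d.sum fun _ e => e) ≤ 1) :
    d = 0 ∨ ∃ i, d = Finsupp.single i 1 := by
  rcases Nat.le_one_iff_eq_zero_or_eq_one.1 hd with h | h
  · left
    exact (Finsupp.degree_eq_zero_iff d).1 h
  · right
    exact (Finsupp.sum_eq_one_iff d).1 h

lemma eval_lineMap {p : MvPolynomial σ F} (hp : p.totalDegree ≤ 1) (x y : σ → F) (t : F) :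
    MvPolynomial.eval (x + t • (y - x)) p =
      MvPolynomial.eval x p + t * (MvPolynomial.eval y p - MvPolynomial.eval x p) := by
  simp only [MvPolynomial.eval_eq, mul_sum, ← sum_sub_distrib, ← sum_add_distrib]
  refine sum_congr rfl fun d hd => ?_
  rcases eq_zero_or_single_of_degree_le_one ((MvPolynomial.le_totalDegree hd).trans hp) with
    rfl | ⟨i, rfl⟩
  · simp
  · simp
    ring

/-- The values at 0 and at the unit vectors recover all coefficients. The degree bound is essential
over a finite field, where nonzero polynomials of higher degree can vanish everywhere. -/
lemma eq_zero_of_eval_eq_zero {p : MvPolynomial σ F} (hp : p.totalDegree ≤ 1)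
    (h : ∀ x, MvPolynomial.eval x p = 0) : p = 0 := by
  classical
  by_contra hne
  obtain ⟨d, hd⟩ := MvPolynomial.ne_zero_iff.1 hne
  have hsupp : ∀ d' ∈ p.support, d' = 0 ∨ ∃ i, d' = Finsupp.single i 1 := fun d' hd' =>
    eq_zero_or_single_of_degree_le_one ((MvPolynomial.le_totalDegree hd').trans hp)
  have h0 : MvPolynomial.coeff 0 p = 0 := by
    rw [← MvPolynomial.constantCoeff_eq, ← MvPolynomial.eval_zero]
    exact h 0
  rcases hsupp d (MvPolynomial.mem_support_iff.2 hd) with rfl | ⟨i, rfl⟩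
  · exact hd h0
  · have h1 := h (Pi.single i 1)
    rw [MvPolynomial.eval_eq, sum_eq_single (Finsupp.single i 1)] at h1
    · simp at h1
      exact hd h1
    · intro d' hd' hne'
      rcases hsupp d' hd' with rfl | ⟨i', rfl⟩
      · exact absurd h0 (MvPolynomial.mem_support_iff.1 hd')
      · have : i' ≠ i := fun he => hne' (by rw [he])
        simp [this]
    · intro hn
      exact absurd (MvPolynomial.mem_support_iff.2 hd) hn

lemma eq_of_eval_eq {p q : MvPolynomial σ F} (hp : p.totalDegree ≤ 1) (hq : q.totalDegree ≤ 1)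
    (h : ∀ x, MvPolynomial.eval x p = MvPolynomial.eval x q) : p = q :=
  sub_eq_zero.1 <| eq_zero_of_eval_eq_zero
    ((MvPolynomial.totalDegree_sub p q).trans (max_le hp hq)) fun x => by
      rw [map_sub, h x, sub_self]

end Polynomials

/-! ### Completions and the independence of the columns. -/

section Completions

variable {σ F ι ι' κ κ' : Type*} [Field F]

lemma hasConstantRank_iff [Fintype κ] {A : Matrix ι κ (MvPolynomial σ F)} {ρ : ℕ} :
    HasConstantRank A ρ ↔ ∀ x, (completion A x).rank = ρ := by
  unfold HasConstantRank rankSet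
  rw [Set.eq_singleton_iff_nonempty_unique_mem]
  exact ⟨fun h x => h.2 _ ⟨x, rfl⟩, fun h => ⟨Set.range_nonempty _, by rintro _ ⟨x, rfl⟩; exact h x⟩⟩

lemma HasConstantRank.unique [Fintype κ] {A : Matrix ι κ (MvPolynomial σ F)} {ρ ρ' : ℕ}
    (h : HasConstantRank A ρ) (h' : HasConstantRank A ρ') : ρ = ρ' :=
  Set.singleton_injective (h.symm.trans h')

@[simp]
lemma completion_apply (A : Matrix ι κ (MvPolynomial σ F)) (x : σ → F) (i : ι) (j : κ) :
    completion A x i j = MvPolynomial.eval x (A i j) := rfl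

lemma completion_submatrix (A : Matrix ι κ (MvPolynomial σ F)) (x : σ → F) (f : ι' → ι)
    (g : κ' → κ) : completion (A.submatrix f g) x = (completion A x).submatrix f g := rfl

lemma completion_mul [Fintype ι] (T : Matrix ι' ι F) (A : Matrix ι κ (MvPolynomial σ F))
    (x : σ → F) :
    completion ((T.map MvPolynomial.C : Matrix ι' ι (MvPolynomial σ F)) * A) x =
      T * completion A x := by
  ext i j
  simp [Matrix.mul_apply]

lemma IsACI.submatrix {A : Matrix ι κ (MvPolynomial σ F)} (hA : IsACI A) (f : ι' → ι)
    {g : κ' → κ} (hg : Function.Injective g) : IsACI (A.submatrix f g) :=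
  ⟨fun i j => hA.1 (f i) (g j), fun i i' _ _ hj => hA.2 (f i) (f i') _ _ (hg.ne hj)⟩

lemma IsACI.mul [Fintype ι] {A : Matrix ι κ (MvPolynomial σ F)} (hA : IsACI A)
    (T : Matrix ι' ι F) :
    IsACI ((T.map MvPolynomial.C : Matrix ι' ι (MvPolynomial σ F)) * A) := by
  classical
  have hvars : ∀ i j, (((T.map MvPolynomial.C : Matrix ι' ι (MvPolynomial σ F)) * A) i j).vars ⊆
      univ.biUnion fun k => (A k j).vars := by
    intro i j
    rw [Matrix.mul_apply]
    refine (MvPolynomial.vars_sum_subset _ _).trans (biUnion_mono fun k _ => ?_)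
    refine (MvPolynomial.vars_mul _ _).trans ?_
    simp
  refine ⟨fun i j => ?_, fun i i' j j' hj => ?_⟩
  · rw [Matrix.mul_apply]
    refine (MvPolynomial.totalDegree_finsetSum _ _).trans (Finset.sup_le fun k _ => ?_)
    refine (MvPolynomial.totalDegree_mul _ _).trans ?_
    simpa using hA.1 k j
  · refine Finset.disjoint_of_subset_left (hvars i j)
      (Finset.disjoint_of_subset_right (hvars i' j') ?_)
    simp only [disjoint_biUnion_left, disjoint_biUnion_right]
    exact fun k _ k' _ => hA.2 _ _ _ _ hj

/-- The set of the values of the column `j` of the completions of `A`. -/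
def colSet (A : Matrix ι κ (MvPolynomial σ F)) (j : κ) : Set (ι → F) :=
  Set.range fun x => (completion A x).col j

lemma colSet_nonempty (A : Matrix ι κ (MvPolynomial σ F)) (j : κ) : (colSet A j).Nonempty :=
  Set.range_nonempty _

lemma IsACI.lineMap_mem_colSet {A : Matrix ι κ (MvPolynomial σ F)} (hA : IsACI A) (j : κ)
    {x y : ι → F} (hx : x ∈ colSet A j) (hy : y ∈ colSet A j) (t : F) :
    x + t • (y - x) ∈ colSet A j := by
  obtain ⟨a, rfl⟩ := hx
  obtain ⟨b, rfl⟩ := hy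
  refine ⟨a + t • (b - a), funext fun i => ?_⟩
  simpa using eval_lineMap (hA.1 i j) a b t

/-- The columns of an ACI-matrix can be completed independently of each other. -/
lemma IsACI.exists_completion_col_eq {A : Matrix ι κ (MvPolynomial σ F)} (hA : IsACI A)
    {c : κ → ι → F} (hc : ∀ j, c j ∈ colSet A j) : ∃ x, (completion A x).col = c := by
  classical
  choose y hy using hc
  -- Each indeterminate takes the value prescribed by the only column in which it occurs; the value
  -- 0 for those that occur nowhere is immaterial.
  refine ⟨fun a => if h : ∃ j i, a ∈ (A i j).vars then y h.choose a else 0,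
    funext fun j => ?_⟩
  rw [← hy j]
  refine funext fun i => ?_
  simp only [Matrix.col_apply, completion_apply]
  refine MvPolynomial.eval₂Hom_congr' rfl (fun a ha _ => ?_) rfl
  have h : ∃ j i, a ∈ (A i j).vars := ⟨j, i, ha⟩
  have hj : h.choose = j := by
    by_contra hne
    obtain ⟨i', hi'⟩ := h.choose_spec
    exact Finset.disjoint_left.1 (hA.2 i' i _ _ hne) hi' ha
  simp only [dif_pos h, hj]

end Completions

/-! ### Ranks of constant block matrices. -/

section Ranks

variable {F : Type*} [Field F] {ι ι' κ κ' : Type*} [Fintype κ] [Fintype κ']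

lemma matrix_rank_add_le (M N : Matrix ι κ F) : (M + N).rank ≤ M.rank + N.rank := by
  rw [Matrix.rank, Matrix.rank, Matrix.rank, Matrix.mulVecLin_add]
  refine (finrank_mono (LinearMap.range_add_le _ _)).trans
    (Submodule.finrank_add_le_finrank_add_finrank _ _)

lemma rank_fromBlocks_le_left [Fintype ι] [DecidableEq ι] [DecidableEq κ] [DecidableEq κ']
    (M : Matrix ι κ F) (Y : Matrix ι κ' F) (N : Matrix ι' κ' F) :
    (Matrix.fromBlocks M Y 0 N).rank ≤ M.rank + Fintype.card κ' := by
  have h : Matrix.fromBlocks M Y 0 N =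
      Matrix.fromRows (1 : Matrix ι ι F) (0 : Matrix ι' ι F) *
        (M * Matrix.fromCols (1 : Matrix κ κ F) (0 : Matrix κ κ' F)) +
        Matrix.fromRows Y N * Matrix.fromCols (0 : Matrix κ' κ F) (1 : Matrix κ' κ' F) := by
    ext (i | i) (j | j) <;>
      simp [Matrix.mul_fromCols, Matrix.fromRows_mul]
  rw [h]
  refine (matrix_rank_add_le _ _).trans (add_le_add ?_ ?_)
  · exact (Matrix.rank_mul_le_right _ _).trans (Matrix.rank_mul_le_left _ _)
  · exact (Matrix.rank_mul_le_right _ _).trans (Matrix.rank_le_card_height _)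

lemma rank_fromRows_eq {M : Matrix ι κ F} (X : Matrix ι' κ F) (hM : M.rank = Fintype.card κ) :
    (Matrix.fromRows X M).rank = Fintype.card κ := by
  refine le_antisymm (Matrix.rank_le_card_width _) ?_
  have := Matrix.rank_submatrix_le (Matrix.fromRows X M) Sum.inr id
  rw [← hM]
  exact this

variable [Fintype ι] [Fintype ι']

lemma exists_right_inverse_of_rank_eq [DecidableEq ι] {M : Matrix ι κ F}
    (h : M.rank = Fintype.card ι) : ∃ R : Matrix κ ι F, M * R = 1 := by
  rw [← Matrix.mulVec_surjective_iff_exists_right_inverse]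
  have : LinearMap.range M.mulVecLin = ⊤ :=
    Submodule.eq_top_of_finrank_eq (by rw [finrank_fintype_fun_eq_card]; exact h)
  exact LinearMap.range_eq_top.1 this

lemma exists_left_inverse_of_rank_eq [DecidableEq κ] {M : Matrix ι κ F}
    (h : M.rank = Fintype.card κ) : ∃ R : Matrix κ ι F, R * M = 1 := by
  obtain ⟨R, hR⟩ := exists_right_inverse_of_rank_eq (M := M.transpose)
    (by rw [Matrix.rank_transpose]; exact h)
  refine ⟨R.transpose, ?_⟩
  rw [← Matrix.transpose_transpose M, ← Matrix.transpose_mul, hR, Matrix.transpose_one]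

lemma rank_mul_of_inverse [DecidableEq ι] {T : Matrix ι' ι F} {S : Matrix ι ι' F}
    (h : S * T = 1) (M : Matrix ι κ F) : (T * M).rank = M.rank := by
  refine le_antisymm (Matrix.rank_mul_le_right _ _) ?_
  have := Matrix.rank_mul_le_right S (T * M)
  rwa [← Matrix.mul_assoc, h, Matrix.one_mul] at this

lemma rank_fromBlocks_le_right [DecidableEq ι] [DecidableEq ι'] [DecidableEq κ']
    (M : Matrix ι κ F) (Y : Matrix ι κ' F) (N : Matrix ι' κ' F) :
    (Matrix.fromBlocks M Y 0 N).rank ≤ Fintype.card ι + N.rank := by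
  have h : Matrix.fromBlocks M Y 0 N =
      Matrix.fromRows (1 : Matrix ι ι F) (0 : Matrix ι' ι F) * Matrix.fromCols M Y +
        Matrix.fromRows (0 : Matrix ι ι' F) (1 : Matrix ι' ι' F) *
          (N * Matrix.fromCols (0 : Matrix κ' κ F) (1 : Matrix κ' κ' F)) := by
    ext (i | i) (j | j) <;>
      simp [Matrix.mul_fromCols, Matrix.fromRows_mul]
  rw [h]
  refine (matrix_rank_add_le _ _).trans (add_le_add ?_ ?_)
  · exact (Matrix.rank_mul_le_left _ _).trans (Matrix.rank_le_card_width _)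
  · exact (Matrix.rank_mul_le_right _ _).trans (Matrix.rank_mul_le_left _ _)

/-- A right inverse of M and a left inverse of N combine to turn the block matrix into an identity
matrix of order |ι| + |κ'|, which bounds the rank from below. -/
lemma rank_fromBlocks_eq {M : Matrix ι κ F} (Y : Matrix ι κ' F) {N : Matrix ι' κ' F}
    (hM : M.rank = Fintype.card ι) (hN : N.rank = Fintype.card κ') :
    (Matrix.fromBlocks M Y 0 N).rank = Fintype.card ι + Fintype.card κ' := by
  classical
  refine le_antisymm (hM ▸ rank_fromBlocks_le_left M Y N) ?_
  obtain ⟨R, hR⟩ := exists_right_inverse_of_rank_eq hM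
  obtain ⟨L, hL⟩ := exists_left_inverse_of_rank_eq hN
  have h : Matrix.fromBlocks (1 : Matrix ι ι F) 0 0 L * (Matrix.fromBlocks M Y 0 N *
      Matrix.fromBlocks R (-(R * Y)) 0 (1 : Matrix κ' κ' F)) =
      (1 : Matrix (ι ⊕ κ') (ι ⊕ κ') F) := by
    simp [Matrix.fromBlocks_multiply, hR, hL, ← Matrix.mul_assoc]
  have h1 := (Matrix.rank_mul_le_right (Matrix.fromBlocks (1 : Matrix ι ι F) 0 0 L)
    (Matrix.fromBlocks M Y 0 N * Matrix.fromBlocks R (-(R * Y)) 0 (1 : Matrix κ' κ' F))).trans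
    (Matrix.rank_mul_le_left _ _)
  rw [h, Matrix.rank_one, Fintype.card_sum] at h1
  exact h1

lemma rank_fromCols_eq {M : Matrix ι κ F} (X : Matrix ι κ' F) (hM : M.rank = Fintype.card ι) :
    (Matrix.fromCols M X).rank = Fintype.card ι := by
  refine le_antisymm (Matrix.rank_le_card_height _) ?_
  have := Matrix.rank_submatrix_le (Matrix.fromCols M X) id Sum.inl
  rw [← hM]
  exact this

end Ranks

/-! ### Equivalence over arbitrary index types, convenient for block matrices. -/

section GeneralEquivalence

variable {σ F : Type*} [Field F] {ι ι' ι'' κ κ' κ'' : Type*} [Fintype ι] [Fintype ι']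
  [Fintype ι''] [DecidableEq ι] [DecidableEq ι'] [DecidableEq ι'']

/-- Equivalence of matrices with arbitrary index types: `B` arises from `A` by a constant invertible
row transformation and a relabelling of the columns. -/
def IndexedEquivalent (A : Matrix ι κ (MvPolynomial σ F)) (B : Matrix ι' κ' (MvPolynomial σ F)) :
    Prop :=
  ∃ (T : Matrix ι' ι F) (S : Matrix ι ι' F) (e : κ' ≃ κ), T * S = 1 ∧ S * T = 1 ∧
    B = ((T.map MvPolynomial.C : Matrix ι' ι (MvPolynomial σ F)) * A).submatrix id e

lemma IndexedEquivalent.trans {A : Matrix ι κ (MvPolynomial σ F)}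
    {B : Matrix ι' κ' (MvPolynomial σ F)} {D : Matrix ι'' κ'' (MvPolynomial σ F)}
    (h : IndexedEquivalent A B) (h' : IndexedEquivalent B D) : IndexedEquivalent A D := by
  obtain ⟨T, S, e, hTS, hST, rfl⟩ := h
  obtain ⟨T', S', e', hTS', hST', rfl⟩ := h'
  refine ⟨T' * T, S * S', e'.trans e, ?_, ?_, ?_⟩
  · rw [Matrix.mul_assoc, ← Matrix.mul_assoc T, hTS, Matrix.one_mul, hTS']
  · rw [Matrix.mul_assoc, ← Matrix.mul_assoc S', hST', Matrix.one_mul, hST]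
  · rw [Matrix.map_mul, Matrix.mul_assoc]
    rfl

lemma indexedEquivalent_submatrix (A : Matrix ι κ (MvPolynomial σ F)) (f : ι' ≃ ι) (e : κ' ≃ κ) :
    IndexedEquivalent A (A.submatrix f e) := by
  refine ⟨(1 : Matrix ι ι F).submatrix f id, (1 : Matrix ι ι F).submatrix id f, e, ?_, ?_, ?_⟩
  · rw [← Matrix.submatrix_mul _ _ _ _ _ Function.bijective_id, Matrix.mul_one,
      Matrix.submatrix_one_equiv]
  · rw [← Matrix.submatrix_mul _ _ _ _ _ f.bijective, Matrix.mul_one]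
    simp
  · ext1 i j
    simp [Matrix.mul_apply, Matrix.one_apply]

lemma IndexedEquivalent.isACI {A : Matrix ι κ (MvPolynomial σ F)}
    {B : Matrix ι' κ' (MvPolynomial σ F)} (h : IndexedEquivalent A B) (hA : IsACI A) : IsACI B := by
  obtain ⟨T, S, e, -, -, rfl⟩ := h
  exact (hA.mul T).submatrix id e.injective

lemma IndexedEquivalent.rank_completion [Fintype κ] [Fintype κ'] {A : Matrix ι κ (MvPolynomial σ F)}
    {B : Matrix ι' κ' (MvPolynomial σ F)} (h : IndexedEquivalent A B) (x : σ → F) :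
    (completion B x).rank = (completion A x).rank := by
  obtain ⟨T, S, e, -, hST, rfl⟩ := h
  rw [completion_submatrix, completion_mul]
  exact (Matrix.rank_submatrix _ (Equiv.refl _) e).trans (rank_mul_of_inverse hST _)

lemma IndexedEquivalent.hasConstantRank_iff [Fintype κ] [Fintype κ']
    {A : Matrix ι κ (MvPolynomial σ F)} {B : Matrix ι' κ' (MvPolynomial σ F)}
    (h : IndexedEquivalent A B) {ρ : ℕ} : HasConstantRank B ρ ↔ HasConstantRank A ρ := by
  simp only [ACI.hasConstantRank_iff, h.rank_completion]

lemma IndexedEquivalent.fromBlocks {ι₁ ι₂ ι₁' ι₂' κ₁ κ₂ κ₁' κ₂' : Type*} [Fintype ι₁] [Fintype ι₂]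
    [Fintype ι₁'] [Fintype ι₂'] [DecidableEq ι₁] [DecidableEq ι₂] [DecidableEq ι₁']
    [DecidableEq ι₂'] {M : Matrix ι₁ κ₁ (MvPolynomial σ F)} {M' : Matrix ι₁' κ₁' (MvPolynomial σ F)}
    {N : Matrix ι₂ κ₂ (MvPolynomial σ F)} {N' : Matrix ι₂' κ₂' (MvPolynomial σ F)}
    (hM : IndexedEquivalent M M') (hN : IndexedEquivalent N N')
    (Y : Matrix ι₁ κ₂ (MvPolynomial σ F)) :
    ∃ Y', IndexedEquivalent (Matrix.fromBlocks M Y 0 N) (Matrix.fromBlocks M' Y' 0 N') := by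
  obtain ⟨T₁, S₁, e₁, hTS₁, hST₁, rfl⟩ := hM
  obtain ⟨T₂, S₂, e₂, hTS₂, hST₂, rfl⟩ := hN
  refine ⟨((T₁.map MvPolynomial.C : Matrix ι₁' ι₁ (MvPolynomial σ F)) * Y).submatrix id e₂,
    Matrix.fromBlocks T₁ 0 0 T₂, Matrix.fromBlocks S₁ 0 0 S₂, Equiv.sumCongr e₁ e₂, ?_, ?_, ?_⟩
  · simp [Matrix.fromBlocks_multiply, hTS₁, hTS₂]
  · simp [Matrix.fromBlocks_multiply, hST₁, hST₂]
  · rw [Matrix.fromBlocks_map, Matrix.fromBlocks_multiply]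
    ext1 (i | i) (j | j) <;> simp [Matrix.fromBlocks]

lemma IndexedEquivalent.fromCols {μ : Type*} {M : Matrix ι κ (MvPolynomial σ F)}
    {M' : Matrix ι' κ' (MvPolynomial σ F)} (hM : IndexedEquivalent M M')
    (X : Matrix ι μ (MvPolynomial σ F)) :
    ∃ X' : Matrix ι' μ (MvPolynomial σ F),
      IndexedEquivalent (Matrix.fromCols M X) (Matrix.fromCols M' X') := by
  obtain ⟨T, S, e, hTS, hST, rfl⟩ := hM
  refine ⟨(T.map MvPolynomial.C : Matrix ι' ι (MvPolynomial σ F)) * X, T, S,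
    Equiv.sumCongr e (Equiv.refl _), hTS, hST, ?_⟩
  rw [Matrix.mul_fromCols]
  ext1 i (j | j) <;> simp

lemma IndexedEquivalent.fromRows {μ : Type*} [Fintype μ] [DecidableEq μ]
    {M : Matrix ι κ (MvPolynomial σ F)}
    {M' : Matrix ι' κ' (MvPolynomial σ F)} (hM : IndexedEquivalent M M')
    (Z : Matrix μ κ (MvPolynomial σ F)) :
    ∃ Z' : Matrix μ κ' (MvPolynomial σ F),
      IndexedEquivalent (Matrix.fromRows Z M) (Matrix.fromRows Z' M') := by
  obtain ⟨T, S, e, hTS, hST, rfl⟩ := hM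
  refine ⟨Z.submatrix id e, Matrix.fromBlocks 1 0 0 T, Matrix.fromBlocks 1 0 0 S, e, ?_, ?_, ?_⟩
  · simp [Matrix.fromBlocks_multiply, hTS]
  · simp [Matrix.fromBlocks_multiply, hST]
  · ext1 (i | i) j <;> simp [Matrix.mul_apply, Fintype.sum_sum_type, Matrix.one_apply]

lemma equivalent_iff_indexedEquivalent {m n : ℕ} {A B : Matrix (Fin m) (Fin n) (MvPolynomial σ F)} :
    Equivalent A B ↔ IndexedEquivalent A B := by
  constructor
  · rintro ⟨T, Q, hT, rfl⟩
    have hdet := (Matrix.isUnit_iff_isUnit_det T).1 hT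
    refine ⟨T, T⁻¹, Q.symm, Matrix.mul_nonsing_inv T hdet, Matrix.nonsing_inv_mul T hdet, ?_⟩
    exact PEquiv.mul_toMatrix_toPEquiv _ _
  · rintro ⟨T, S, e, hTS, hST, rfl⟩
    refine ⟨T, e.symm, ⟨⟨T, S, hTS, hST⟩, rfl⟩, ?_⟩
    exact PEquiv.mul_toMatrix_toPEquiv _ _

end GeneralEquivalence

/-! ### Reduction of constant rank ACI-matrices. -/

section Reduction

variable {σ F : Type*} [Field F]

/-- A surjective linear map `g` extends to an invertible constant matrix whose last rows are `g`. -/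
lemma exists_invertible_fromRows {m r : ℕ} (g : (Fin m → F) →ₗ[F] (Fin r → F))
    (hg : Function.Surjective g) {p : ℕ} (hp : finrank F (LinearMap.ker g) = p) :
    ∃ (K : Matrix (Fin p) (Fin m) F) (S : Matrix (Fin m) (Fin p ⊕ Fin r) F),
      Matrix.fromRows K (LinearMap.toMatrix' g) * S = 1 ∧
      S * Matrix.fromRows K (LinearMap.toMatrix' g) = 1 := by
  obtain ⟨π, hπ⟩ := LinearMap.exists_leftInverse_of_injective (LinearMap.ker g).subtype
    (Submodule.ker_subtype _)
  let b : LinearMap.ker g ≃ₗ[F] (Fin p → F) :=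
    LinearEquiv.ofFinrankEq _ _ (by rw [hp, finrank_fin_fun])
  -- The added rows are coordinates on ker g of a projection onto ker g, so a vector killed by all
  -- rows lies in ker g and projects to 0.
  set K := LinearMap.toMatrix' (b.toLinearMap ∘ₗ π) with hK
  set M := Matrix.fromRows K (LinearMap.toMatrix' g) with hM
  have hcard : Fintype.card (Fin p ⊕ Fin r) = Fintype.card (Fin m) := by
    have h1 := LinearMap.finrank_range_add_finrank_ker g
    rw [LinearMap.range_eq_top.2 hg, finrank_top, finrank_fin_fun, finrank_fin_fun, hp] at h1
    rw [Fintype.card_sum, Fintype.card_fin, Fintype.card_fin, Fintype.card_fin]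
    omega
  have hker : ∀ z, M.mulVec z = 0 → z = 0 := by
    intro z hz
    rw [hM, Matrix.fromRows_mulVec] at hz
    have h1 : K.mulVec z = 0 := funext fun i => congrFun hz (Sum.inl i)
    have h2 : (LinearMap.toMatrix' g).mulVec z = 0 := funext fun i => congrFun hz (Sum.inr i)
    rw [hK, LinearMap.toMatrix'_mulVec] at h1
    rw [LinearMap.toMatrix'_mulVec] at h2
    have h3 : π z = 0 := by simpa using h1
    have h4 : π z = ⟨z, h2⟩ := congrArg (fun f => f ⟨z, h2⟩) hπ
    rw [h3] at h4
    exact (congrArg Subtype.val h4).symm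
  have hrank : M.rank = Fintype.card (Fin m) := by
    have h1 := LinearMap.finrank_range_add_finrank_ker M.mulVecLin
    rw [LinearMap.ker_eq_bot'.2 hker, finrank_bot, finrank_fin_fun] at h1
    rw [Fintype.card_fin]
    exact h1
  obtain ⟨S, hS⟩ := exists_right_inverse_of_rank_eq (hrank.trans hcard.symm)
  obtain ⟨S', hS'⟩ := exists_left_inverse_of_rank_eq hrank
  have : S = S' := by
    calc S = S' * M * S := by rw [hS', Matrix.one_mul]
      _ = S' := by rw [Matrix.mul_assoc, hS, Matrix.mul_one]
  exact ⟨K, S, hS, this ▸ hS'⟩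

/-- A linear surjection onto a coordinate space with prescribed kernel. -/
lemma exists_surjective_ker_eq {m r : ℕ} (U : Submodule F (Fin m → F))
    (hU : finrank F U + r = m) :
    ∃ g : (Fin m → F) →ₗ[F] (Fin r → F), Function.Surjective g ∧ LinearMap.ker g = U := by
  have h := Submodule.finrank_quotient_add_finrank U
  rw [finrank_fin_fun] at h
  let b : ((Fin m → F) ⧸ U) ≃ₗ[F] (Fin r → F) :=
    LinearEquiv.ofFinrankEq _ _ (by rw [finrank_fin_fun]; omega)
  refine ⟨b.toLinearMap ∘ₗ U.mkQ, b.surjective.comp U.mkQ_surjective, ?_⟩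
  rw [LinearMap.ker_comp, LinearEquiv.ker, Submodule.comap_bot, Submodule.ker_mkQ]

/-- An injection from `Fin q` extends to an equivalence from `Fin q ⊕ Fin l`. -/
lemma exists_sum_equiv {q n l : ℕ} (f : Fin q ↪ Fin n) (hn : n = q + l) :
    ∃ e : Fin q ⊕ Fin l ≃ Fin n, ∀ i, e (Sum.inl i) = f i := by
  classical
  have hcard : Fintype.card ((Set.range f)ᶜ : Set (Fin n)) = l := by
    rw [Fintype.card_compl_set, Set.card_range_of_injective f.injective, Fintype.card_fin,
      Fintype.card_fin]
    omega
  refine ⟨(Equiv.sumCongr (Equiv.ofInjective f f.injective)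
    (Fintype.equivFinOfCardEq hcard).symm).trans (Equiv.Set.sumCompl (Set.range f)), fun i => ?_⟩
  simp

/-- A square ACI-matrix of full rank is equivalent to a unitriangular one. -/
theorem IsACI.exists_unitriangular {n : ℕ} {A : Matrix (Fin n) (Fin n) (MvPolynomial σ F)}
    (hA : IsACI A) (hr : HasConstantRank A n) :
    ∃ U : Matrix (Fin n) (Fin n) (MvPolynomial σ F),
      IsUpperUnitriangular U ∧ IndexedEquivalent A U := by
  have hr' := hasConstantRank_iff.1 hr
  obtain ⟨e, he⟩ := exists_triangular_order n (colSet A) (colSet_nonempty A)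
    (fun i x hx y hy t => hA.lineMap_mem_colSet i hx hy t) (finrank_fin_fun F) (by
      intro c hc
      obtain ⟨x, hx⟩ := hA.exists_completion_col_eq hc
      rw [linearIndependent_iff_card_eq_finrank_span, ← hx, Set.finrank,
        ← Matrix.rank_eq_finrank_span_cols, hr', Fintype.card_fin])
  -- The completion at 0, with its columns in the triangular order, is taken as the new basis; any
  -- other completion would do.
  set N : Matrix (Fin n) (Fin n) F := (completion A 0).submatrix id e with hN
  have hNrank : N.rank = Fintype.card (Fin n) := by
    rw [hN, Fintype.card_fin]
    exact (Matrix.rank_submatrix _ (Equiv.refl _) e).trans (hr' 0)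
  obtain ⟨T, hTN⟩ := exists_left_inverse_of_rank_eq hNrank
  have hNT : N * T = 1 := mul_eq_one_comm.1 hTN
  have hTc : ∀ i, T.mulVec ((completion A 0).col (e i)) = Pi.single i 1 := by
    intro i
    have : T.mulVec (N.col i) = (T * N).col i := by
      ext a; simp [Matrix.mul_apply, Matrix.mulVec, dotProduct]
    rw [hTN] at this
    refine this.trans (funext fun a => ?_)
    simp [Matrix.one_apply, Pi.single_apply]
  -- The span of the first i vectors of the new basis. It contains all values of the first i
  -- columns, as each differs from its value at 0 by an element of the previous span.
  let K : Fin n → Submodule F (Fin n → F) := fun i =>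
    { carrier := {z | ∀ a, i ≤ a → T.mulVec z a = 0}
      add_mem' := fun hx hy a ha => by rw [Matrix.mulVec_add, Pi.add_apply, hx a ha, hy a ha, add_zero]
      zero_mem' := fun a _ => by rw [Matrix.mulVec_zero]; rfl
      smul_mem' := fun t x hx a ha => by
        rw [Matrix.mulVec_smul, Pi.smul_apply, hx a ha, smul_zero] }
  have hK : ∀ i, spanOf F (fun j => colSet A (e j)) (univ.filter (· < i)) ≤ K i := by
    intro i
    induction i using WellFoundedLT.induction with
    | ind i ih =>
    refine spanOf_le.2 fun j hj z hz a ha => ?_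
    have hji : j < i := (mem_filter.1 hj).2
    have h1 := ih j hji (he j ((completion A 0).col (e j)) ⟨0, rfl⟩ z hz) a (hji.le.trans ha)
    rw [Matrix.mulVec_sub, Pi.sub_apply, hTc, Pi.single_eq_of_ne (hji.trans_le ha).ne', sub_zero]
      at h1
    exact h1
  have hentry : ∀ i j (x : σ → F), j ≤ i →
      T.mulVec ((completion A x).col (e j)) i = (Pi.single j 1 : Fin n → F) i := by
    intro i j x hji
    have h1 := hK j (he j ((completion A 0).col (e j)) ⟨0, rfl⟩
      ((completion A x).col (e j)) ⟨x, rfl⟩) i hji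
    rw [Matrix.mulVec_sub, Pi.sub_apply, hTc, sub_eq_zero] at h1
    exact h1
  have hequiv : IndexedEquivalent A
      (((T.map MvPolynomial.C : Matrix (Fin n) (Fin n) (MvPolynomial σ F)) * A).submatrix id e) := by
    refine ⟨T, (completion A 0).submatrix id e, e, hTN, hNT, rfl⟩
  have hU := hequiv.isACI hA
  have heval : ∀ i j (x : σ → F), MvPolynomial.eval x
      (((T.map MvPolynomial.C : Matrix (Fin n) (Fin n) (MvPolynomial σ F)) * A).submatrix id e i j)
      = T.mulVec ((completion A x).col (e j)) i := by
    intro i j x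
    have := congrFun (congrFun (completion_mul T A x) i) (e j)
    exact this
  refine ⟨_, ⟨hU, rfl, fun i j hji => ?_, fun i j hij => ?_⟩, hequiv⟩
  · refine eq_zero_of_eval_eq_zero (hU.1 i j) fun x => ?_
    have hlt : j < i := hji
    rw [heval, hentry i j x hlt.le, Pi.single_eq_of_ne hlt.ne']
  · obtain rfl : i = j := Fin.ext hij
    refine eq_of_eval_eq (hU.1 i i) (by simp) fun x => ?_
    rw [heval, hentry i i x le_rfl, Pi.single_eq_same, map_one]

/-- An ACI-matrix of full row rank contains, up to equivalence, a unitriangular or minimal full rank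
matrix made of its first columns. -/
theorem IsACI.exists_fromCols {p s : ℕ} {A : Matrix (Fin p) (Fin s) (MvPolynomial σ F)}
    (hA : IsACI A) (hr : HasConstantRank A p) :
    ∃ (q l : ℕ) (_ : s = q + l) (B : Matrix (Fin p) (Fin q) (MvPolynomial σ F))
      (X : Matrix (Fin p) (Fin l) (MvPolynomial σ F)),
      (IsUpperUnitriangular B ∨ IsMinimalFullRank B) ∧
      IndexedEquivalent A (Matrix.fromCols B X) := by
  classical
  -- The least number of columns keeping full row rank; deleting a further column then destroys it.
  have hex : ∃ q, ∃ f : Fin q ↪ Fin s, HasConstantRank (A.submatrix id f) p :=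
    ⟨s, Function.Embedding.refl _, hr⟩
  obtain ⟨f, hf⟩ := Nat.find_spec hex
  have hmin : ∀ q' < Nat.find hex, ¬ ∃ f : Fin q' ↪ Fin s, HasConstantRank (A.submatrix id f) p :=
    fun q' hq' => Nat.find_min hex hq'
  generalize Nat.find hex = q at f hf hmin
  have hqs : q ≤ s := by simpa using Fintype.card_le_of_embedding f
  have hpq : p ≤ q := by
    rw [← hasConstantRank_iff.1 hf 0]
    exact Matrix.rank_le_width _
  obtain ⟨e, he⟩ := exists_sum_equiv f (l := s - q) (by omega)
  have hB := hA.submatrix id f.injective (ι' := Fin p)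
  have hequiv : IndexedEquivalent A (Matrix.fromCols (A.submatrix id f)
      (A.submatrix id fun i => e (Sum.inr i))) := by
    convert indexedEquivalent_submatrix A (Equiv.refl _) e using 1
    ext1 i (j | j) <;> simp [he]
  rcases hpq.eq_or_lt with rfl | hlt
  · obtain ⟨U, hU, hBU⟩ := hB.exists_unitriangular hf
    obtain ⟨X, hX⟩ := hBU.fromCols (A.submatrix id fun i => e (Sum.inr i))
    exact ⟨p, s - p, by omega, U, X, Or.inl hU, hequiv.trans hX⟩
  · refine ⟨q, s - q, by omega, _, _, Or.inr ⟨hB, hf, hlt, fun j hfull => ?_⟩, hequiv⟩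
    obtain ⟨q, rfl⟩ : ∃ q', q = q' + 1 := ⟨q - 1, by omega⟩
    refine hmin q (by omega) ⟨(Fin.succAboveEmb j).trans f, ?_⟩
    unfold IsFullRank at hfull
    rw [Fintype.card_fin, Fintype.card_subtype_compl, Fintype.card_fin, Fintype.card_subtype_eq,
      min_eq_left (by omega)] at hfull
    rw [← (indexedEquivalent_submatrix _ (Equiv.refl (Fin p))
      (finSuccAboveEquiv j)).hasConstantRank_iff] at hfull
    exact hfull

/-- If `[M w]` has independent columns, so does the image of `M` under a map with kernel `F w`. -/
lemma rank_toMatrix'_mul_of_rank_augment {u v r : ℕ} {M : Matrix (Fin u) (Fin v) F} {w : Fin u → F}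
    (h : (Matrix.fromCols M (Matrix.of fun i (_ : Unit) => w i)).rank = v + 1)
    (g : (Fin u → F) →ₗ[F] (Fin r → F)) (hg : LinearMap.ker g = span F {w}) :
    (LinearMap.toMatrix' g * M).rank = v := by
  obtain ⟨R, hR⟩ := exists_left_inverse_of_rank_eq (M :=
    Matrix.fromCols M (Matrix.of fun i (_ : Unit) => w i)) (by simpa using h)
  have hker : ∀ z, (LinearMap.toMatrix' g * M).mulVec z = 0 → z = 0 := by
    intro z hz
    rw [← Matrix.mulVec_mulVec, LinearMap.toMatrix'_mulVec] at hz
    have hz' : M.mulVec z ∈ span F {w} := hg ▸ hz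
    obtain ⟨t, ht⟩ := mem_span_singleton.1 hz'
    -- A vector z with M z = t w yields the relation (z, -t) among the columns of [M w], so z = 0.
    have h1 : (Matrix.fromCols M (Matrix.of fun i (_ : Unit) => w i)).mulVec
        (Sum.elim z fun _ => -t) = 0 := by
      rw [Matrix.fromCols_mulVec_sumElim, ← ht]
      ext i
      simp [Matrix.mulVec, dotProduct, mul_comm]
    have h2 := congrArg R.mulVec h1
    rw [Matrix.mulVec_mulVec, hR, Matrix.one_mulVec, Matrix.mulVec_zero] at h2
    exact funext fun i => congrFun h2 (Sum.inl i)
  have h1 := LinearMap.finrank_range_add_finrank_ker (LinearMap.toMatrix' g * M).mulVecLin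
  rw [LinearMap.ker_eq_bot'.2 hker, finrank_bot, finrank_fin_fun] at h1
  exact h1

/-- An ACI-matrix of full column rank contains, up to equivalence, a unitriangular or maximal full
rank matrix made of its last rows. -/
theorem IsACI.exists_fromRows {r v : ℕ} {A : Matrix (Fin r) (Fin v) (MvPolynomial σ F)}
    (hA : IsACI A) (hr : HasConstantRank A v) :
    ∃ (k u : ℕ) (_ : r = k + u) (Z : Matrix (Fin k) (Fin v) (MvPolynomial σ F))
      (C : Matrix (Fin u) (Fin v) (MvPolynomial σ F)),
      (IsUpperUnitriangular C ∨ IsMaximalFullRank C) ∧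
      IndexedEquivalent A (Matrix.fromRows Z C) := by
  classical
  -- Selecting rows after a change of basis amounts to applying a linear surjection, so the least u
  -- is sought over all of these.
  have hex : ∃ u, ∃ g : (Fin r → F) →ₗ[F] (Fin u → F), Function.Surjective g ∧
      HasConstantRank (((LinearMap.toMatrix' g).map MvPolynomial.C :
        Matrix (Fin u) (Fin r) (MvPolynomial σ F)) * A) v :=
    ⟨r, LinearMap.id, Function.surjective_id, by
      rw [LinearMap.toMatrix'_id, Matrix.map_one _ (map_zero _) (map_one _), Matrix.one_mul]
      exact hr⟩
  obtain ⟨g, hg, hgr⟩ := Nat.find_spec hex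
  have hmin : ∀ u' < Nat.find hex, _ := fun u' hu' => Nat.find_min hex hu'
  generalize Nat.find hex = u at g hg hgr hmin
  have hdim := LinearMap.finrank_range_add_finrank_ker g
  rw [LinearMap.range_eq_top.2 hg, finrank_top, finrank_fin_fun, finrank_fin_fun] at hdim
  have hvu : v ≤ u := by
    rw [← hasConstantRank_iff.1 hgr 0]
    exact Matrix.rank_le_height _
  obtain ⟨K, S, hKS, hSK⟩ := exists_invertible_fromRows g hg rfl
  have hC := hA.mul (LinearMap.toMatrix' g)
  have hequiv : IndexedEquivalent A (Matrix.fromRows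
      ((K.map MvPolynomial.C : Matrix _ (Fin r) (MvPolynomial σ F)) * A)
      (((LinearMap.toMatrix' g).map MvPolynomial.C : Matrix (Fin u) (Fin r) (MvPolynomial σ F)) *
        A)) := by
    refine ⟨Matrix.fromRows K (LinearMap.toMatrix' g), S, Equiv.refl _, hKS, hSK, ?_⟩
    ext1 (i | i) j <;> simp [Matrix.mul_apply]
  rcases hvu.eq_or_lt with rfl | hlt
  · obtain ⟨U, hU, hCU⟩ := hC.exists_unitriangular hgr
    obtain ⟨Z, hZ⟩ := hCU.fromRows
      ((K.map MvPolynomial.C : Matrix _ (Fin r) (MvPolynomial σ F)) * A)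
    exact ⟨_, v, by omega, Z, U, Or.inl hU, hequiv.trans hZ⟩
  · refine ⟨_, u, by omega, _, _, Or.inr ⟨hC, hgr, hlt, fun w hfull => ?_⟩, hequiv⟩
    unfold IsFullRank at hfull
    rw [Fintype.card_fin, Fintype.card_sum, Fintype.card_fin, Fintype.card_unit,
      min_eq_right (by omega), hasConstantRank_iff] at hfull
    have hcompl : ∀ x, completion (augment (((LinearMap.toMatrix' g).map MvPolynomial.C :
        Matrix (Fin u) (Fin r) (MvPolynomial σ F)) * A) w) x =
        Matrix.fromCols (LinearMap.toMatrix' g * completion A x)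
          (Matrix.of fun i (_ : Unit) => w i) := by
      intro x
      rw [← completion_mul]
      ext1 i (j | j) <;> simp [augment]
    simp only [hcompl] at hfull
    -- A zero column cannot raise the rank from v to v + 1. With w nonzero, dividing by its line
    -- lowers u by exactly one.
    have hw : w ≠ 0 := by
      rintro rfl
      have h1 := hfull 0
      have h2 : Matrix.fromCols (LinearMap.toMatrix' g * completion A 0)
          (Matrix.of fun i (_ : Unit) => (0 : Fin u → F) i) =
          (LinearMap.toMatrix' g * completion A 0) *
            Matrix.fromCols (1 : Matrix (Fin v) (Fin v) F) (0 : Matrix (Fin v) Unit F) := by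
        rw [Matrix.mul_fromCols, Matrix.mul_one, Matrix.mul_zero]
        rfl
      rw [h2] at h1
      have h3 := (Matrix.rank_mul_le_left (LinearMap.toMatrix' g * completion A 0)
        (Matrix.fromCols (1 : Matrix (Fin v) (Fin v) F) (0 : Matrix (Fin v) Unit F))).trans
        (Matrix.rank_le_width _)
      omega
    obtain ⟨u, rfl⟩ : ∃ u', u = u' + 1 := ⟨u - 1, by omega⟩
    obtain ⟨g', hg', hker⟩ := exists_surjective_ker_eq (r := u) (span F {w})
      (by rw [finrank_span_singleton hw]; omega)
    -- If [gA w] is full rank, the columns of gA stay independent modulo w, contrary to the choice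
    -- of u.
    refine hmin u (by omega) ⟨g' ∘ₗ g, hg'.comp hg, hasConstantRank_iff.2 fun x => ?_⟩
    rw [completion_mul, LinearMap.toMatrix'_comp, Matrix.mul_assoc]
    exact rank_toMatrix'_mul_of_rank_augment (hfull x) g' hker

/-- A constant rank ACI-matrix is equivalent to a block triangular one whose diagonal blocks have
full row rank and full column rank. -/
theorem IsACI.exists_fromBlocks {m n ρ : ℕ} {A : Matrix (Fin m) (Fin n) (MvPolynomial σ F)}
    (hA : IsACI A) (hr : HasConstantRank A ρ) :
    ∃ (p r s v : ℕ) (_ : m = p + r) (_ : n = s + v) (_ : p + v = ρ)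
      (M : Matrix (Fin p) (Fin s) (MvPolynomial σ F))
      (Y : Matrix (Fin p) (Fin v) (MvPolynomial σ F))
      (N : Matrix (Fin r) (Fin v) (MvPolynomial σ F)),
      IsACI M ∧ HasConstantRank M p ∧ IsACI N ∧ HasConstantRank N v ∧
      IndexedEquivalent A (Matrix.fromBlocks M Y 0 N) := by
  have hr' := hasConstantRank_iff.1 hr
  obtain ⟨S, hS⟩ := exists_spanOf_of_rank_le (F := F) (colSet A) (colSet_nonempty A) ρ (by
    intro c hc
    obtain ⟨x, hx⟩ := hA.exists_completion_col_eq hc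
    rw [← hx, ← Matrix.rank_eq_finrank_span_cols, hr'])
  rw [Fintype.card_fin] at hS
  set U := spanOf F (colSet A) S with hU
  have hUm : finrank F U ≤ m := by simpa using Submodule.finrank_le U
  have hSn : #S ≤ n := by simpa using S.card_le_univ
  obtain ⟨g, hg, hker⟩ := exists_surjective_ker_eq (r := m - finrank F U) U (by omega)
  obtain ⟨K, S', hKS, hSK⟩ := exists_invertible_fromRows g hg (p := finrank F U) (by rw [hker])
  obtain ⟨e, he⟩ := exists_sum_equiv (S.orderEmbOfFin rfl).toEmbedding (l := n - #S) (by omega)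
  have heS : ∀ j, e (Sum.inl j) ∈ S := fun j => by
    rw [he]; exact S.orderEmbOfFin_mem rfl j
  have hequiv : IndexedEquivalent A ((((Matrix.fromRows K (LinearMap.toMatrix' g)).map
      MvPolynomial.C : Matrix _ _ (MvPolynomial σ F)) * A).submatrix id e) :=
    ⟨_, S', e, hKS, hSK, rfl⟩
  set G := ((((Matrix.fromRows K (LinearMap.toMatrix' g)).map
      MvPolynomial.C : Matrix _ _ (MvPolynomial σ F)) * A).submatrix id e) with hG
  have hGA := hequiv.isACI hA
  have hzero : G.toBlocks₂₁ = 0 := by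
    ext1 i j
    refine eq_zero_of_eval_eq_zero (hGA.1 _ _) fun x => ?_
    have h1 : (completion A x).col (e (Sum.inl j)) ∈ LinearMap.ker g := by
      rw [hker]
      exact subset_spanOf (colSet A) (heS j) ⟨x, rfl⟩
    have h2 := congrFun (congrFun (completion_mul (Matrix.fromRows K (LinearMap.toMatrix' g)) A x)
      (Sum.inr i)) (e (Sum.inl j))
    refine Eq.trans h2 ?_
    have h3 := congrFun (LinearMap.mem_ker.1 h1) i
    rw [← LinearMap.toMatrix'_mulVec] at h3
    exact h3
  have hblocks : G = Matrix.fromBlocks G.toBlocks₁₁ G.toBlocks₁₂ 0 G.toBlocks₂₂ := by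
    rw [← hzero, Matrix.fromBlocks_toBlocks]
  have hcompl : ∀ x, completion G x = Matrix.fromBlocks (completion G.toBlocks₁₁ x)
      (completion G.toBlocks₁₂ x) 0 (completion G.toBlocks₂₂ x) := by
    intro x
    have : completion G.toBlocks₂₁ x = 0 := by rw [hzero]; ext; simp
    rw [← this]
    exact (Matrix.fromBlocks_toBlocks (completion G x)).symm
  -- The rank ρ is at most rank M + (n - |S|) and at most dim U + rank N, while dim U + (n - |S|) ≤
  -- ρ. This squeezes both ranks to their maximal values.
  have hM : ∀ x, finrank F U ≤ (completion G.toBlocks₁₁ x).rank ∧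
      n - #S ≤ (completion G.toBlocks₂₂ x).rank ∧ ρ ≤ finrank F U + (n - #S) := by
    intro x
    have h0 := (hequiv.rank_completion x).trans (hr' x)
    rw [hcompl] at h0
    have h1 := rank_fromBlocks_le_left (completion G.toBlocks₁₁ x)
      (completion G.toBlocks₁₂ x) (completion G.toBlocks₂₂ x)
    have h2 := rank_fromBlocks_le_right (completion G.toBlocks₁₁ x)
      (completion G.toBlocks₁₂ x) (completion G.toBlocks₂₂ x)
    have h3 := (completion G.toBlocks₁₁ x).rank_le_height
    rw [Fintype.card_fin] at h1 h2
    omega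
  refine ⟨finrank F U, m - finrank F U, #S, n - #S, by omega, by omega, ?_, G.toBlocks₁₁,
    G.toBlocks₁₂, G.toBlocks₂₂, hGA.submatrix Sum.inl Sum.inl_injective, ?_,
    hGA.submatrix Sum.inr Sum.inr_injective, ?_, hblocks ▸ hequiv⟩
  · have := (hM 0).2.2
    omega
  · exact hasConstantRank_iff.2 fun x => le_antisymm (Matrix.rank_le_height _) (hM x).1
  · exact hasConstantRank_iff.2 fun x => le_antisymm (Matrix.rank_le_width _) (hM x).2.1

end Reduction

/-! ### From the reductions to the block forms and patterns. -/

section Forms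

variable {σ F : Type*} [Field F]

lemma IsUpperUnitriangular.isUpperTriangular {a b : ℕ}
    {A : Matrix (Fin a) (Fin b) (MvPolynomial σ F)} (h : IsUpperUnitriangular A) :
    IsUpperTriangular A :=
  ⟨h.1, h.2.1, h.2.2.1, fun i j hij => ⟨1, one_ne_zero, by rw [h.2.2.2 i j hij, map_one]⟩⟩

lemma IsUpperTriangular.rank_completion {a b : ℕ}
    {A : Matrix (Fin a) (Fin b) (MvPolynomial σ F)} (h : IsUpperTriangular A) (x : σ → F) :
    (completion A x).rank = a := by
  obtain ⟨-, rfl, hlow, hdiag⟩ := h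
  have htri : (completion A x).IsUpperTriangular := fun i j hij => by
    rw [completion_apply, hlow i j hij, map_zero]
  have hdet : IsUnit (completion A x).det := by
    rw [Matrix.det_of_isUpperTriangular htri, isUnit_iff_ne_zero, prod_ne_zero_iff]
    intro i _
    obtain ⟨t, ht, hAt⟩ := hdiag i i rfl
    rwa [completion_apply, hAt, MvPolynomial.eval_C]
  rw [Matrix.rank_of_isUnit _ ((Matrix.isUnit_iff_isUnit_det _).2 hdet), Fintype.card_fin]

lemma rank_completion_of_triangular_or_minimal {a b : ℕ}
    {B : Matrix (Fin a) (Fin b) (MvPolynomial σ F)}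
    (h : IsUpperTriangular B ∨ IsMinimalFullRank B) (x : σ → F) :
    (completion B x).rank = Fintype.card (Fin a) := by
  rw [Fintype.card_fin]
  exact h.elim (fun h => h.rank_completion x) fun h => hasConstantRank_iff.1 h.2.1 x

lemma rank_completion_of_triangular_or_maximal {a b : ℕ}
    {C : Matrix (Fin a) (Fin b) (MvPolynomial σ F)}
    (h : IsUpperTriangular C ∨ IsMaximalFullRank C) (x : σ → F) :
    (completion C x).rank = Fintype.card (Fin b) := by
  rw [Fintype.card_fin]
  exact h.elim (fun h => (h.rank_completion x).trans h.2.1) fun h => hasConstantRank_iff.1 h.2.1 x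

lemma completion_fromCols {ι κ κ' : Type*} (B : Matrix ι κ (MvPolynomial σ F))
    (X : Matrix ι κ' (MvPolynomial σ F)) (x : σ → F) :
    completion (Matrix.fromCols B X) x =
      Matrix.fromCols (completion B x) (completion X x) := by
  ext i (j | j) <;> rfl

lemma completion_fromRows {ι ι' κ : Type*} (Z : Matrix ι κ (MvPolynomial σ F))
    (C : Matrix ι' κ (MvPolynomial σ F)) (x : σ → F) :
    completion (Matrix.fromRows Z C) x =
      Matrix.fromRows (completion Z x) (completion C x) := by
  ext (i | i) j <;> rfl

lemma completion_fromBlocks {ι ι' κ κ' : Type*} (M : Matrix ι κ (MvPolynomial σ F))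
    (Y : Matrix ι κ' (MvPolynomial σ F)) (N : Matrix ι' κ' (MvPolynomial σ F)) (x : σ → F) :
    completion (Matrix.fromBlocks M Y 0 N) x =
      Matrix.fromBlocks (completion M x) (completion Y x) 0 (completion N x) := by
  ext (i | i) (j | j) <;> simp [completion]

lemma indexedEquivalent_hcat {m n q l : ℕ} (hn : n = q + l)
    (B : Matrix (Fin m) (Fin q) (MvPolynomial σ F))
    (X : Matrix (Fin m) (Fin l) (MvPolynomial σ F)) :
    IndexedEquivalent (Matrix.fromCols B X) ((hcat B X).submatrix id (Fin.cast hn)) :=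
  indexedEquivalent_submatrix _ (Equiv.refl _) ((finCongr hn).trans finSumFinEquiv.symm)

lemma indexedEquivalent_vcat {m n k u : ℕ} (hm : m = k + u)
    (Z : Matrix (Fin k) (Fin n) (MvPolynomial σ F))
    (C : Matrix (Fin u) (Fin n) (MvPolynomial σ F)) :
    IndexedEquivalent (Matrix.fromRows Z C) ((vcat Z C).submatrix (Fin.cast hm) id) :=
  indexedEquivalent_submatrix _ ((finCongr hm).trans finSumFinEquiv.symm) (Equiv.refl _)

lemma blockMatrix_eq_submatrix {R : Type*} [Zero R] {p k u q l v : ℕ}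
    (B : Matrix (Fin p) (Fin q) R) (X : Matrix (Fin p) (Fin l) R) (Y : Matrix (Fin p) (Fin v) R)
    (Z : Matrix (Fin k) (Fin v) R) (C : Matrix (Fin u) (Fin v) R) :
    blockMatrix B X Y Z C =
      (Matrix.fromBlocks (Matrix.fromCols B X) Y 0 (Matrix.fromRows Z C)).submatrix
        ((finSumFinEquiv.symm.trans (Equiv.sumCongr finSumFinEquiv.symm (Equiv.refl _))).trans
          (Equiv.sumAssoc _ _ _))
        (finSumFinEquiv.symm.trans (Equiv.sumCongr finSumFinEquiv.symm (Equiv.refl _))) := by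
  ext i j
  obtain ⟨i, rfl⟩ := finSumFinEquiv.surjective i
  obtain ⟨j, rfl⟩ := finSumFinEquiv.surjective j
  rcases i with i | i
  · obtain ⟨i, rfl⟩ := finSumFinEquiv.surjective i
    rcases j with j | j
    · obtain ⟨j, rfl⟩ := finSumFinEquiv.surjective j
      rcases i with i | i <;> rcases j with j | j <;> simp [blockMatrix, vcat, hcat]
    · rcases i with i | i <;> simp [blockMatrix, vcat, hcat]
  · rcases j with j | j
    · obtain ⟨j, rfl⟩ := finSumFinEquiv.surjective j
      rcases j with j | j <;> simp [blockMatrix, vcat, hcat]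
    · simp [blockMatrix, vcat, hcat]

lemma indexedEquivalent_blockMatrix {m n p k u q l v : ℕ} (hm : m = p + k + u)
    (hn : n = q + l + v) (B : Matrix (Fin p) (Fin q) (MvPolynomial σ F))
    (X : Matrix (Fin p) (Fin l) (MvPolynomial σ F)) (Y : Matrix (Fin p) (Fin v) (MvPolynomial σ F))
    (Z : Matrix (Fin k) (Fin v) (MvPolynomial σ F)) (C : Matrix (Fin u) (Fin v) (MvPolynomial σ F)) :
    IndexedEquivalent (Matrix.fromBlocks (Matrix.fromCols B X) Y 0 (Matrix.fromRows Z C))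
      ((blockMatrix B X Y Z C).submatrix (Fin.cast hm) (Fin.cast hn)) := by
  rw [blockMatrix_eq_submatrix]
  exact (indexedEquivalent_submatrix _ _ _).trans
    (indexedEquivalent_submatrix _ (finCongr hm) (finCongr hn))

/-- The case of a void last block column: Y and N have no entries, so only zero rows remain below [B
X]. -/
lemma indexedEquivalent_vcat_hcat_zero {m n p k u q l : ℕ} (hm : m = p + (k + u))
    (hn : n = q + l) (B : Matrix (Fin p) (Fin q) (MvPolynomial σ F))
    (X : Matrix (Fin p) (Fin l) (MvPolynomial σ F)) (Y : Matrix (Fin p) (Fin 0) (MvPolynomial σ F))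
    (N : Matrix (Fin k ⊕ Fin u) (Fin 0) (MvPolynomial σ F)) :
    IndexedEquivalent (Matrix.fromBlocks (Matrix.fromCols B X) Y 0 N)
      ((vcat (hcat B X) (0 : Matrix (Fin (k + u)) (Fin (q + l)) (MvPolynomial σ F))).submatrix
        (Fin.cast hm) (Fin.cast hn)) := by
  have h : vcat (hcat B X) (0 : Matrix (Fin (k + u)) (Fin (q + l)) (MvPolynomial σ F)) =
      (Matrix.fromBlocks (Matrix.fromCols B X) Y 0 N).submatrix
        (finSumFinEquiv.symm.trans (Equiv.sumCongr (Equiv.refl _) finSumFinEquiv.symm))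
        (finSumFinEquiv.symm.trans (Equiv.sumEmpty _ _).symm) := by
    ext1 i j
    obtain ⟨i, rfl⟩ := finSumFinEquiv.surjective i
    obtain ⟨j, rfl⟩ := finSumFinEquiv.surjective j
    rcases i with i | i <;> simp [vcat, hcat]
  rw [h]
  exact (indexedEquivalent_submatrix _ _ _).trans
    (indexedEquivalent_submatrix _ (finCongr hm) (finCongr hn))

/-- The case of a void first block row: M and Y have no entries, so only zero columns remain to the
left of Z and C. -/
lemma indexedEquivalent_hcat_zero_vcat {m n k u q l v : ℕ} (hm : m = k + u)
    (hn : n = (q + l) + v) (M : Matrix (Fin 0) (Fin q ⊕ Fin l) (MvPolynomial σ F))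
    (Y : Matrix (Fin 0) (Fin v) (MvPolynomial σ F)) (Z : Matrix (Fin k) (Fin v) (MvPolynomial σ F))
    (C : Matrix (Fin u) (Fin v) (MvPolynomial σ F)) :
    IndexedEquivalent (Matrix.fromBlocks M Y 0 (Matrix.fromRows Z C))
      ((hcat (0 : Matrix (Fin (k + u)) (Fin (q + l)) (MvPolynomial σ F)) (vcat Z C)).submatrix
        (Fin.cast hm) (Fin.cast hn)) := by
  have h : hcat (0 : Matrix (Fin (k + u)) (Fin (q + l)) (MvPolynomial σ F)) (vcat Z C) =
      (Matrix.fromBlocks M Y 0 (Matrix.fromRows Z C)).submatrix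
        (finSumFinEquiv.symm.trans (Equiv.emptySum _ _).symm)
        (finSumFinEquiv.symm.trans (Equiv.sumCongr finSumFinEquiv.symm (Equiv.refl _))) := by
    ext1 i j
    obtain ⟨i, rfl⟩ := finSumFinEquiv.surjective i
    obtain ⟨j, rfl⟩ := finSumFinEquiv.surjective j
    rcases j with j | j <;> simp [vcat, hcat]
  rw [h]
  exact (indexedEquivalent_submatrix _ _ _).trans
    (indexedEquivalent_submatrix _ (finCongr hm) (finCongr hn))

/-- The canonical block form of a constant rank ACI-matrix. -/
theorem IsACI.exists_block_form {m n ρ : ℕ} {A : Matrix (Fin m) (Fin n) (MvPolynomial σ F)}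
    (hA : IsACI A) (hr : HasConstantRank A ρ) :
    ∃ (p k u q l v : ℕ) (_ : m = p + k + u) (_ : n = q + l + v) (_ : p + v = ρ)
      (B : Matrix (Fin p) (Fin q) (MvPolynomial σ F))
      (X : Matrix (Fin p) (Fin l) (MvPolynomial σ F))
      (Y : Matrix (Fin p) (Fin v) (MvPolynomial σ F))
      (Z : Matrix (Fin k) (Fin v) (MvPolynomial σ F))
      (C : Matrix (Fin u) (Fin v) (MvPolynomial σ F)),
      (IsUpperUnitriangular B ∨ IsMinimalFullRank B) ∧
      (IsUpperUnitriangular C ∨ IsMaximalFullRank C) ∧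
      IndexedEquivalent A
        (Matrix.fromBlocks (Matrix.fromCols B X) Y 0 (Matrix.fromRows Z C)) := by
  obtain ⟨p, r, s, v, hm, hn, hρ, M, Y, N, hM, hMr, hN, hNr, hequiv⟩ := hA.exists_fromBlocks hr
  obtain ⟨q, l, hs, B, X, hB, hMB⟩ := hM.exists_fromCols hMr
  obtain ⟨k, u, hr, Z, C, hC, hNC⟩ := hN.exists_fromRows hNr
  obtain ⟨Y', hY'⟩ := hMB.fromBlocks hNC Y
  exact ⟨p, k, u, q, l, v, by omega, by omega, hρ, B, X, Y', Z, C, hB, hC, hequiv.trans hY'⟩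

theorem HasBlockForm.hasConstantRank {m n ρ : ℕ} {A : Matrix (Fin m) (Fin n) (MvPolynomial σ F)}
    (h : HasBlockForm A ρ) : HasConstantRank A ρ := by
  obtain ⟨p, k, u, q, l, v, hm, hn, B, X, Y, Z, C, hB, hC, rfl, hequiv⟩ := h
  rw [← (equivalent_iff_indexedEquivalent.1 hequiv).hasConstantRank_iff,
    (indexedEquivalent_blockMatrix hm hn B X Y Z C).hasConstantRank_iff, hasConstantRank_iff]
  intro x
  rw [completion_fromBlocks, completion_fromCols, completion_fromRows,
    rank_fromBlocks_eq _ (rank_fromCols_eq _ (rank_completion_of_triangular_or_minimal hB x))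
      (rank_fromRows_eq _ (rank_completion_of_triangular_or_maximal hC x)),
    Fintype.card_fin, Fintype.card_fin]

theorem IsACI.hasBlockForm {m n ρ : ℕ} {A : Matrix (Fin m) (Fin n) (MvPolynomial σ F)}
    (hA : IsACI A) (hr : HasConstantRank A ρ) : HasBlockForm A ρ := by
  obtain ⟨p, k, u, q, l, v, hm, hn, hρ, B, X, Y, Z, C, hB, hC, hequiv⟩ := hA.exists_block_form hr
  exact ⟨p, k, u, q, l, v, hm, hn, B, X, Y, Z, C,
    hB.imp_left fun h => h.isUpperTriangular, hC.imp_left fun h => h.isUpperTriangular, hρ,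
    equivalent_iff_indexedEquivalent.2
      (hequiv.trans (indexedEquivalent_blockMatrix hm hn B X Y Z C))⟩

theorem HasRowForm.hasConstantRank {m n : ℕ} {A : Matrix (Fin m) (Fin n) (MvPolynomial σ F)}
    (h : HasRowForm A) : HasConstantRank A m := by
  obtain ⟨-, q, l, hn, B, X, hB, hequiv⟩ := h
  rw [← (equivalent_iff_indexedEquivalent.1 hequiv).hasConstantRank_iff,
    (indexedEquivalent_hcat hn B X).hasConstantRank_iff, hasConstantRank_iff]
  intro x
  rw [completion_fromCols, rank_fromCols_eq _ (rank_completion_of_triangular_or_minimal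
    (hB.imp (fun h => h.isUpperTriangular) fun h => h.1) x), Fintype.card_fin]

theorem HasColForm.hasConstantRank {m n : ℕ} {A : Matrix (Fin m) (Fin n) (MvPolynomial σ F)}
    (h : HasColForm A) : HasConstantRank A n := by
  obtain ⟨-, u, k, hm, Z, C, hC, hequiv⟩ := h
  rw [← (equivalent_iff_indexedEquivalent.1 hequiv).hasConstantRank_iff,
    (indexedEquivalent_vcat hm Z C).hasConstantRank_iff, hasConstantRank_iff]
  intro x
  rw [completion_fromRows, rank_fromRows_eq _ (rank_completion_of_triangular_or_maximal
    (hC.imp (fun h => h.isUpperTriangular) fun h => h.1) x), Fintype.card_fin]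

theorem IsACI.hasRowForm {m n : ℕ} {A : Matrix (Fin m) (Fin n) (MvPolynomial σ F)}
    (hA : IsACI A) (hr : HasConstantRank A m) (hmn : m < n) : HasRowForm A := by
  obtain ⟨q, l, hn, B, X, hB, hequiv⟩ := hA.exists_fromCols hr
  exact ⟨hmn, q, l, hn, B, X, hB.imp_right fun h => ⟨h, h.2.2.1, by omega⟩,
    equivalent_iff_indexedEquivalent.2 (hequiv.trans (indexedEquivalent_hcat hn B X))⟩

theorem IsACI.hasColForm {m n : ℕ} {A : Matrix (Fin m) (Fin n) (MvPolynomial σ F)}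
    (hA : IsACI A) (hr : HasConstantRank A n) (hmn : n < m) : HasColForm A := by
  obtain ⟨k, u, hm, Z, C, hC, hequiv⟩ := hA.exists_fromRows hr
  exact ⟨hmn, u, k, hm, Z, C, hC.imp_right fun h => ⟨h, h.2.2.1, by omega⟩,
    equivalent_iff_indexedEquivalent.2 (hequiv.trans (indexedEquivalent_vcat hm Z C))⟩

theorem IsACI.pattern {m n ρ : ℕ} {A : Matrix (Fin m) (Fin n) (MvPolynomial σ F)}
    (hA : IsACI A) (hr : HasConstantRank A ρ) (hρ : 1 ≤ ρ) (hlt : ρ < min m n) :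
    PatternA A ρ ∨ PatternB A ρ ∨ PatternC A ρ := by
  obtain ⟨p, k, u, q, l, v, hm, hn, hpv, B, X, Y, Z, C, hB, hC, hequiv⟩ := hA.exists_block_form hr
  have h1 := hlt.trans_le (min_le_left m n)
  have h2 := hlt.trans_le (min_le_right m n)
  -- As p + v = ρ ≥ 1, p and v are not both zero: v = 0 gives pattern (b), p = 0 gives (c), and
  -- otherwise (a) holds. The strict size conditions restate ρ < m and ρ < n.
  rcases Nat.eq_zero_or_pos v with rfl | hv
  · refine Or.inr (Or.inl ⟨k + u, by omega, by omega, by omega, by omega, ?_⟩)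
    rw [show m - (k + u) = p by omega]
    exact ⟨q, l, by omega, by omega, B, X, hB, equivalent_iff_indexedEquivalent.2
      (hequiv.trans (indexedEquivalent_vcat_hcat_zero (by omega) (by omega) B X Y _))⟩
  rcases Nat.eq_zero_or_pos p with rfl | hp
  · refine Or.inr (Or.inr ⟨q + l, by omega, by omega, by omega, by omega, ?_⟩)
    rw [show n - (q + l) = v by omega]
    exact ⟨k, u, by omega, by omega, Z, C, hC, equivalent_iff_indexedEquivalent.2
      (hequiv.trans (indexedEquivalent_hcat_zero_vcat (by omega) (by omega) _ Y Z C))⟩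
  · refine Or.inl ⟨k + u, q + l, by omega, by omega, by omega, by omega, by omega, by omega,
      by omega, ?_⟩
    rw [show m - (k + u) = p by omega, show n - (q + l) = v by omega]
    exact ⟨k, u, q, l, hm, hn, B, X, Y, Z, C, hB, hC, equivalent_iff_indexedEquivalent.2
      (hequiv.trans (indexedEquivalent_blockMatrix hm hn B X Y Z C))⟩

end Forms

end ACI

theorem mainTheorem1 {F σ : Type*} [Field F] (m n : ℕ)
    (A : Matrix (Fin m) (Fin n) (MvPolynomial σ F)) (hA : ACI.IsACI A) (ρ : ℕ) :
    (ACI.HasConstantRank A ρ ↔ ACI.HasBlockForm A ρ) ∧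
    (ACI.HasConstantRank A ρ → 1 ≤ ρ → ρ ≤ min m n →
      ((ρ = m ∧ m = n) ↔
        ∃ U : Matrix (Fin m) (Fin n) (MvPolynomial σ F),
          ACI.IsUpperUnitriangular U ∧ ACI.Equivalent A U) ∧
      ((ρ = m ∧ m < n) ↔ ACI.HasRowForm A) ∧
      ((ρ = n ∧ n < m) ↔ ACI.HasColForm A) ∧
      (ρ < min m n ↔ ACI.PatternA A ρ ∨ ACI.PatternB A ρ ∨ ACI.PatternC A ρ)) := by
  refine ⟨⟨hA.hasBlockForm, ACI.HasBlockForm.hasConstantRank⟩, fun hr hρ _ => ⟨⟨?_, ?_⟩, ⟨?_, ?_⟩,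
    ⟨?_, ?_⟩, hA.pattern hr hρ, ?_⟩⟩
  · rintro ⟨rfl, rfl⟩
    obtain ⟨U, hU, hequiv⟩ := hA.exists_unitriangular hr
    exact ⟨U, hU, ACI.equivalent_iff_indexedEquivalent.2 hequiv⟩
  · rintro ⟨U, hU, hequiv⟩
    have hUr : ACI.HasConstantRank U m :=
      ACI.hasConstantRank_iff.2 hU.isUpperTriangular.rank_completion
    rw [(ACI.equivalent_iff_indexedEquivalent.1 hequiv).hasConstantRank_iff] at hUr
    exact ⟨hr.unique hUr, hU.2.1⟩
  · rintro ⟨rfl, hlt⟩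
    exact hA.hasRowForm hr hlt
  · exact fun h => ⟨hr.unique h.hasConstantRank, h.1⟩
  · rintro ⟨rfl, hlt⟩
    exact hA.hasColForm hr hlt
  · exact fun h => ⟨hr.unique h.hasConstantRank, h.1⟩
  -- The numerical conditions alone bound ρ here; in (a), m - r < s and n - s < r give ρ < n and ρ <
  -- m.
  · rintro (⟨r, s, _, _, _, _, _, _, _, -⟩ | ⟨r, _, _, _, _, -⟩ | ⟨s, _, _, _, _, -⟩) <;>
      exact lt_min (by omega) (by omega)
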